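/- Let $M$ be a smooth ($\sigma$-compact, Hausdorff) $n$-dimensional manifold without boundary and let $P$ be a continuous fibre seminorm on $T^*M$: each $P_x$ is a seminorm on $T_x^*M$, and $P\colon T^*M\to[0,\infty)$ is continuous. Put $Z(P_x)=\{\xi\in T^*_xM : P(\xi)=0\}$ and $P^*_x(v)=\sup\{|\xi(v)| : \xi\in T^*_xM,\ P(\xi)\le 1\}\in[0,\infty]$ for $v\in T_xM$. A curve $\gamma\colon[a,b]\to M$ is $P$-subunit if it is absolutely continuous and $P^*(\gamma'(t))\le 1$ for almost all $t\in[a,b]$. Let $\varrho_P(x,y)\in[0,\infty]$ be the infimum of all $T>0$ for which there is a $P$-subunit curve $\gamma\colon[0,T]\to M$ with $\gamma(0)=x$ and $\gamma(T)=y$, and let the $P$-length of a continuous curve $\gamma\colon[a,b]\to M$ be $$\ell_P(\gamma)=\sup\Bigl\{\sum_{j=1}^m\varrho_P(\gamma(t_{j-1}),\gamma(t_j)) : m\in\mathbb N,\ a=t_0\le\dots\le t_m=b\Bigr\}\in[0,\infty].$$ (1) Suppose that $x\mapsto\dim Z(P_x)$ is continuous (that is, locally constant) on $M$, that $a<b$,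 and that $\gamma\colon[a,b]\to M$ is a curve of class $C^1$. Then $\ell_P(\gamma)$ is the infimum (in $[0,\infty]$, with $\inf\emptyset=\infty$) of the set of all $T>0$ for which there is a smooth diffeomorphism $r\colon[0,T]\to[a,b]$ such that $\gamma\circ r$ is $P$-subunit. (2) The continuity hypothesis cannot be dropped: there are a continuous fibre seminorm $P$ on $T^*\mathbb R^2$ and a smooth curve $\gamma\colon[0,1]\to\mathbb R^2$ such that $\ell_P(\gamma)$ is not equal to the infimum in (1). More precisely, $P$ and $\gamma$ may be chosen so that, in addition, $\ell_P(\gamma)\le 3/2$, while $T\ge 2$ whenever $T>0$ and $r$ is a $C^1$ map of $[0,T]$ onto $[0,1]$ such that $\gamma\circ r$ is $P$-subunit. -/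

import Mathlib

open Set MeasureTheory
open scoped Manifold ContDiff ENNReal

/-- Euclidean `n`-space, the model space of the manifolds considered. -/
abbrev EucSp (n : ℕ) : Type := EuclideanSpace ℝ (Fin n)

/-- The fibre `T*ₓM` of the cotangent bundle: (continuous) linear functionals on `TₓM`. -/
abbrev CotangentFibre (n : ℕ) (M : Type*) [TopologicalSpace M] [ChartedSpace (EucSp n) M]
    (x : M) : Type :=
  TangentSpace 𝓘(ℝ, EucSp n) x →L[ℝ] ℝ

/-- A continuous fibre seminorm on `T*M`: a seminorm `P x` on every fibre `T*ₓM`, such that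
`(x, ξ) ↦ P x ξ` is continuous on the total space of the cotangent bundle (the bundle of
homomorphisms from `TM` to the trivial line bundle, with Mathlib's vector bundle topology). -/
structure FibreSeminorm (n : ℕ) (M : Type*) [TopologicalSpace M] [ChartedSpace (EucSp n) M]
    [IsManifold 𝓘(ℝ, EucSp n) ∞ M] where
  /-- the seminorm on each fibre -/
  seminorm : ∀ x : M, Seminorm ℝ (CotangentFibre n M x)
  continuous_seminorm : Continuous
    (fun ξ : Bundle.TotalSpace (EucSp n →L[ℝ] ℝ) (CotangentFibre n M) => seminorm ξ.1 ξ.2)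

namespace FibreSeminorm

variable {n : ℕ} {M : Type*} [TopologicalSpace M] [ChartedSpace (EucSp n) M]
  [IsManifold 𝓘(ℝ, EucSp n) ∞ M]

/-- The dual extended fibre norm `P*ₓ(v) = sup {|ξ(v)| : P(ξ) ≤ 1}`, with values in `[0, ∞]`. -/
noncomputable def dualNorm (P : FibreSeminorm n M) (x : M)
    (v : TangentSpace 𝓘(ℝ, EucSp n) x) : ℝ≥0∞ :=
  ⨆ ξ : {ξ : CotangentFibre n M x // P.seminorm x ξ ≤ 1}, ENNReal.ofReal |ξ.1 v|

/-- The zero subspace `Z(Pₓ) = {ξ ∈ T*ₓM : P(ξ) = 0}`. -/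
def zeroSubspace (P : FibreSeminorm n M) (x : M) : Submodule ℝ (CotangentFibre n M x) where
  carrier := {ξ | P.seminorm x ξ = 0}
  zero_mem' := map_zero (P.seminorm x)
  add_mem' := by
    intro ξ η hξ hη
    have h := map_add_le_add (P.seminorm x) ξ η
    rw [mem_ofPred_eq] at hξ hη
    rw [hξ, hη, add_zero] at h
    exact le_antisymm h (apply_nonneg (P.seminorm x) (ξ + η))
  smul_mem' := by
    intro c ξ hξ
    rw [mem_ofPred_eq] at hξ ⊢
    rw [map_smul_eq_mul, hξ, mul_zero]

end FibreSeminorm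

/-- Absolute continuity on `[a, b]` of a curve in `M`: the curve is continuous, and its expression
in every chart of the atlas is absolutely continuous on every compact subinterval that the curve
maps into the domain of the chart. -/
def IsACCurve (n : ℕ) {M : Type*} [TopologicalSpace M] [ChartedSpace (EucSp n) M]
    (γ : ℝ → M) (a b : ℝ) : Prop :=
  ContinuousOn γ (Icc a b) ∧
    ∀ φ ∈ atlas (EucSp n) M, ∀ c d : ℝ, a ≤ c → c ≤ d → d ≤ b → MapsTo γ (Icc c d) φ.source →
      AbsolutelyContinuousOnInterval (fun t => φ (γ t)) c d

namespace FibreSeminorm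

variable {n : ℕ} {M : Type*} [TopologicalSpace M] [ChartedSpace (EucSp n) M]
  [IsManifold 𝓘(ℝ, EucSp n) ∞ M]

/-- A curve on `[a, b]` (only the values of `γ` on `[a, b]` matter) is `P`-subunit if it is
absolutely continuous and `P*(γ'(t)) ≤ 1` for almost all `t ∈ [a, b]`. An absolutely continuous
curve is differentiable almost everywhere, so `mfderiv` is its genuine derivative at almost all
`t`. -/
def IsSubunitCurve (P : FibreSeminorm n M) (γ : ℝ → M) (a b : ℝ) : Prop :=
  IsACCurve n γ a b ∧
    ∀ᵐ t ∂(volume.restrict (Icc a b)),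
      P.dualNorm (γ t) (mfderiv 𝓘(ℝ, ℝ) 𝓘(ℝ, EucSp n) γ t (1 : ℝ)) ≤ 1

/-- The extended distance `ϱ_P(x, y)`: the infimum of all `T > 0` such that some `P`-subunit curve
on `[0, T]` goes from `x` to `y` (and `∞` if there is none). -/
noncomputable def controlDist (P : FibreSeminorm n M) (x y : M) : ℝ≥0∞ :=
  ⨅ T ∈ {T : ℝ | 0 < T ∧ ∃ γ : ℝ → M, P.IsSubunitCurve γ 0 T ∧ γ 0 = x ∧ γ T = y},
    ENNReal.ofReal T

/-- The `P`-length of a curve on `[a, b]`: the supremum of `∑ⱼ ϱ_P(γ(tⱼ), γ(tⱼ₊₁))` over all finite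
subdivisions `a = t₀ ≤ t₁ ≤ ⋯ ≤ tₘ = b`. -/
noncomputable def curveLength (P : FibreSeminorm n M) (γ : ℝ → M) (a b : ℝ) : ℝ≥0∞ :=
  ⨆ p : {p : ℕ × (ℕ → ℝ) // Monotone p.2 ∧ p.2 0 = a ∧ p.2 p.1 = b},
    ∑ j ∈ Finset.range p.1.1, P.controlDist (γ (p.1.2 j)) (γ (p.1.2 (j + 1)))

end FibreSeminorm

/-- `r` restricts to a smooth diffeomorphism from the interval `s` onto the interval `t`: it is a
bijection of `s` onto `t` that is smooth up to the end points, and so is its inverse `q`. -/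
def IsSmoothDiffeoOn (r : ℝ → ℝ) (s t : Set ℝ) : Prop :=
  ContDiffOn ℝ ∞ r s ∧ MapsTo r s t ∧
    ∃ q : ℝ → ℝ, ContDiffOn ℝ ∞ q t ∧ MapsTo q t s ∧ InvOn q r s t

/-- The set of all `T > 0` for which there is a smooth diffeomorphism `r : [0, T] → [a, b]` such
that `γ ∘ r` is `P`-subunit. -/
def FibreSeminorm.smoothReparamTimes {n : ℕ} {M : Type*} [TopologicalSpace M]
    [ChartedSpace (EucSp n) M] [IsManifold 𝓘(ℝ, EucSp n) ∞ M]
    (P : FibreSeminorm n M) (γ : ℝ → M) (a b : ℝ) : Set ℝ :=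
  {T | 0 < T ∧ ∃ r : ℝ → ℝ, IsSmoothDiffeoOn r (Icc 0 T) (Icc a b) ∧
    P.IsSubunitCurve (γ ∘ r) 0 T}

/-! The formula compares the length with the integral of the speed `P*(γ')`. A subunit
reparametrisation on `[0, T]` bounds every subdivision sum by `T`, since its pieces, reversed if
necessary, compete in the control distances (`IsSubunitCurve.curveLength_le`).

Conversely, fix a time and let `k` be below the speed there. Some covector `ξ` with `P(ξ) < 1`
exceeds `k` on the velocity. Read in a chart, `ξ` grows at rate at most 1 along short subunit curves
and at rate at least `k` along `γ`, so the control distance is locally at least `k (t - s)`.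
Summing, the length dominates the integral of every continuous function below the speed
(`ofReal_integral_le_curveLength`). The speed is always lower semicontinuous. If the null spaces
have locally constant dimension, one fixed complement serves as a space of test covectors at all
nearby points, so the speed is locally either infinite or bounded, and continuous where finite
(`exists_complement_of_finrank_seminormKer`). Finite length excludes infinite speed, and a smooth
function slightly above the then continuous speed integrates to the inverse of the required
reparametrisation.

For the counterexample take `max (|ξ₁|/2, |ξ₁ + a(x₁) ξ₂|)`. The unit horizontal vector has dual
norm 2 where `a ≠ 0` and 1 where `a = 0`. If `a ≠ 0` on a dense open set of small measure, a
Lipschitz reparametrisation can exploit the zeros of `a`, whereas a `C¹` one has rate at most 1/2 on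
a dense set, hence everywhere. -/

open Filter Topology

/-! ### Semicontinuity of the norm dual to a varying seminorm -/

section PolarNorm

variable {X E : Type*} [TopologicalSpace X] [NormedAddCommGroup E] [NormedSpace ℝ E]

/-- The extended norm dual to a seminorm on the space of functionals. -/
noncomputable def polarNorm (p : Seminorm ℝ (E →L[ℝ] ℝ)) (w : E) : ℝ≥0∞ :=
  ⨆ ξ : {ξ : E →L[ℝ] ℝ // p ξ ≤ 1}, ENNReal.ofReal |ξ.1 w|

/-- The null space of a seminorm. -/
def seminormKer {F : Type*} [AddCommGroup F] [Module ℝ F] (p : Seminorm ℝ F) :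
    Submodule ℝ F where
  carrier := {ξ | p ξ = 0}
  zero_mem' := map_zero p
  add_mem' := by
    intro ξ η hξ hη
    have h := map_add_le_add p ξ η
    rw [mem_ofPred_eq] at hξ hη
    rw [hξ, hη, add_zero] at h
    exact le_antisymm h (apply_nonneg p (ξ + η))
  smul_mem' := by
    intro c ξ hξ
    rw [mem_ofPred_eq] at hξ ⊢
    rw [map_smul_eq_mul, hξ, mul_zero]

lemma mem_seminormKer {F : Type*} [AddCommGroup F] [Module ℝ F] {p : Seminorm ℝ F} {ξ : F} :
    ξ ∈ seminormKer p ↔ p ξ = 0 := Iff.rfl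

lemma ofReal_abs_apply_le_polarNorm {p : Seminorm ℝ (E →L[ℝ] ℝ)} {ξ : E →L[ℝ] ℝ} (hξ : p ξ ≤ 1)
    (w : E) : ENNReal.ofReal |ξ w| ≤ polarNorm p w :=
  le_iSup (fun ξ : {ξ : E →L[ℝ] ℝ // p ξ ≤ 1} => ENNReal.ofReal |ξ.1 w|) ⟨ξ, hξ⟩

lemma polarNorm_le_iff {p : Seminorm ℝ (E →L[ℝ] ℝ)} {w : E} {a : ℝ≥0∞} :
    polarNorm p w ≤ a ↔ ∀ ξ : E →L[ℝ] ℝ, p ξ ≤ 1 → ENNReal.ofReal |ξ w| ≤ a := by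
  simp [polarNorm, iSup_le_iff]

/-- A functional is dominated by its seminorm times the dual norm of the vector. -/
lemma abs_apply_le_mul_of_polarNorm_le {p : Seminorm ℝ (E →L[ℝ] ℝ)} {w : E} {c : ℝ} (hc : 0 ≤ c)
    (h : polarNorm p w ≤ ENNReal.ofReal c) (ξ : E →L[ℝ] ℝ) : |ξ w| ≤ p ξ * c := by
  rw [polarNorm_le_iff] at h
  -- As `p ξ` may vanish, `ξ` is normalised by an arbitrary `k > p ξ`, and `k` then decreases to `p
  -- ξ`.
  have key : ∀ k : ℝ, p ξ < k → |ξ w| ≤ k * c := by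
    intro k hk
    have hk0 : 0 < k := (apply_nonneg p ξ).trans_lt hk
    have h1 : p (k⁻¹ • ξ) ≤ 1 := by
      rw [map_smul_eq_mul, Real.norm_of_nonneg (inv_nonneg.2 hk0.le), inv_mul_le_iff₀ hk0]
      linarith
    have h2 := (ENNReal.ofReal_le_ofReal_iff hc).1 (h _ h1)
    rw [smul_apply, smul_eq_mul, abs_mul, abs_of_pos (inv_pos.2 hk0),
      inv_mul_le_iff₀ hk0] at h2
    exact h2
  have hlim : Tendsto (fun k : ℝ => k * c) (𝓝[>] (p ξ)) (𝓝 (p ξ * c)) :=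
    ((continuous_id.mul continuous_const).tendsto _).mono_left nhdsWithin_le_nhds
  refine ge_of_tendsto hlim ?_
  filter_upwards [self_mem_nhdsWithin] with k hk using key k hk

lemma apply_eq_zero_of_polarNorm_ne_top {p : Seminorm ℝ (E →L[ℝ] ℝ)} {w : E}
    (h : polarNorm p w ≠ ⊤) {ξ : E →L[ℝ] ℝ} (hξ : p ξ = 0) : ξ w = 0 := by
  have := abs_apply_le_mul_of_polarNorm_le ENNReal.toReal_nonneg
    (ENNReal.ofReal_toReal h).ge ξ
  rw [hξ, zero_mul] at this
  exact abs_nonpos_iff.1 this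

/-- Shrinking an almost optimal covector slightly makes `p ξ < 1` strict, and a sign change removes
the absolute value. Strictness lets the same `ξ` serve at all nearby base points. -/
lemma exists_lt_apply_of_lt_polarNorm {p : Seminorm ℝ (E →L[ℝ] ℝ)} {w : E} {a : ℝ≥0∞}
    (h : a < polarNorm p w) : ∃ ξ : E →L[ℝ] ℝ, p ξ < 1 ∧ a < ENNReal.ofReal (ξ w) := by
  obtain ⟨⟨ξ, hξ⟩, hlt⟩ := lt_iSup_iff.1 h
  have hcont : Continuous fun s : ℝ => ENNReal.ofReal |(s • ξ) w| := by
    refine ENNReal.continuous_ofReal.comp ?_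
    simp only [smul_apply, smul_eq_mul]
    fun_prop
  have h1 : ∀ᶠ s : ℝ in 𝓝[<] 1, a < ENNReal.ofReal |(s • ξ) w| :=
    nhdsWithin_le_nhds (hcont.continuousAt.eventually_const_lt (by simpa using hlt))
  have h2 : ∀ᶠ s : ℝ in 𝓝[<] 1, s ∈ Ioo 0 1 := Ioo_mem_nhdsLT one_pos
  obtain ⟨s, hs, hs0, hs1⟩ := (h1.and h2).exists
  have hp : p (s • ξ) < 1 := by
    rw [map_smul_eq_mul, Real.norm_of_nonneg hs0.le]
    calc s * p ξ ≤ s * 1 := by gcongr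
      _ < 1 := by linarith
  rcases le_total 0 ((s • ξ) w) with h0 | h0
  · exact ⟨s • ξ, hp, by rwa [abs_of_nonneg h0] at hs⟩
  · refine ⟨-(s • ξ), by rwa [map_neg_eq_map], ?_⟩
    rw [abs_of_nonpos h0] at hs
    simpa using hs

variable {p : X → Seminorm ℝ (E →L[ℝ] ℝ)} {x₀ : X}

/-- Lower semicontinuity needs no condition on the null spaces: one good covector remains admissible
and good nearby. -/
lemma eventually_lt_polarNorm
    (hp : ∀ ξ, ContinuousAt (fun z : X × (E →L[ℝ] ℝ) => p z.1 z.2) (x₀, ξ))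
    {w₀ : E} {a : ℝ≥0∞} (h : a < polarNorm (p x₀) w₀) :
    ∀ᶠ z : X × E in 𝓝 (x₀, w₀), a < polarNorm (p z.1) z.2 := by
  obtain ⟨ξ, hξ, hlt⟩ := exists_lt_apply_of_lt_polarNorm h
  have h1 : ∀ᶠ x in 𝓝 x₀, p x ξ < 1 := by
    have : ContinuousAt (fun x => p x ξ) x₀ :=
      ContinuousAt.comp (f := fun x => (x, ξ)) (hp ξ) (by fun_prop)
    exact this.eventually_lt_const hξ
  have h2 : ∀ᶠ w in 𝓝 w₀, a < ENNReal.ofReal |ξ w| := by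
    have : Continuous fun w => ENNReal.ofReal |ξ w| :=
      ENNReal.continuous_ofReal.comp (continuous_abs.comp ξ.continuous)
    exact this.continuousAt.eventually_const_lt
      (hlt.trans_le (ENNReal.ofReal_le_ofReal (le_abs_self _)))
  filter_upwards [(h1.prod_nhds h2)] with z hz
  exact hz.2.trans_le (ofReal_abs_apply_le_polarNorm hz.1.le _)

lemma exists_bound_of_continuousAt
    (hp : ContinuousAt (fun z : X × (E →L[ℝ] ℝ) => p z.1 z.2) (x₀, 0)) :
    ∃ C > 0, ∀ᶠ x in 𝓝 x₀, ∀ ξ, p x ξ ≤ C * ‖ξ‖ := by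
  have h : ∀ᶠ z : X × (E →L[ℝ] ℝ) in 𝓝 (x₀, 0), p z.1 z.2 < 1 :=
    hp.eventually_lt_const (by simp)
  rw [nhds_prod_eq, (𝓝 x₀).basis_sets.prod Metric.nhds_basis_ball |>.eventually_iff] at h
  obtain ⟨⟨U, η⟩, ⟨hU, hη⟩, h⟩ := h
  refine ⟨2 / η, by positivity, ?_⟩
  filter_upwards [hU] with x hx ξ
  by_cases hξ : ξ = 0
  · simp [hξ]
  have hn : 0 < ‖ξ‖ := norm_pos_iff.2 hξ
  have hpos : 0 < η / 2 / ‖ξ‖ := by positivity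
  have h1 : p x ((η / 2 / ‖ξ‖) • ξ) < 1 := by
    refine h (x := (x, (η / 2 / ‖ξ‖) • ξ)) ⟨hx, ?_⟩
    rw [mem_ball_zero_iff, norm_smul, Real.norm_of_nonneg hpos.le, div_mul_cancel₀ _ hn.ne']
    exact half_lt_self hη
  rw [map_smul_eq_mul, Real.norm_of_nonneg hpos.le, ← lt_div_iff₀' hpos] at h1
  refine h1.le.trans (le_of_eq ?_)
  field_simp

variable [FiniteDimensional ℝ E]

/-- If the null spaces have locally constant dimension, then the functionals on which the dual norm
is tested can be restricted to a fixed complement of the null space at one point. -/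
lemma exists_complement_of_finrank_seminormKer
    (hp : ∀ ξ, ContinuousAt (fun z : X × (E →L[ℝ] ℝ) => p z.1 z.2) (x₀, ξ))
    (hdim : ∀ᶠ x in 𝓝 x₀, Module.finrank ℝ (seminormKer (p x)) =
      Module.finrank ℝ (seminormKer (p x₀))) :
    ∃ C > 0, ∀ k > 1, ∀ᶠ x in 𝓝 x₀, ∀ ξ, p x ξ ≤ 1 →
      ∃ u, p x (ξ - u) = 0 ∧ p x₀ u ≤ k ∧ ‖u‖ ≤ k * C := by
  obtain ⟨W, hW⟩ := Submodule.exists_isCompl (seminormKer (p x₀))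
  have hslice : ∀ ξ, ContinuousAt (p x₀) ξ := fun ξ =>
    ContinuousAt.comp (f := fun ξ => (x₀, ξ)) (hp ξ) (by fun_prop)
  have hpos : ∀ w ∈ W, w ≠ 0 → 0 < p x₀ w := by
    intro w hw hw0
    refine lt_of_le_of_ne (apply_nonneg _ _) fun h => hw0 ?_
    exact (Submodule.disjoint_def.1 hW.disjoint) w h.symm hw
  set S : Set (E →L[ℝ] ℝ) := Metric.sphere 0 1 ∩ W with hS
  have hScompact : IsCompact S :=
    (isCompact_sphere _ _).inter_right (Submodule.closed_of_finiteDimensional W)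
  have hSpos : ∀ w ∈ S, 0 < p x₀ w := by
    rintro w ⟨hw1, hw2⟩
    refine hpos w hw2 ?_
    rintro rfl
    simp at hw1
  have hscale : ∀ w ∈ W, w ≠ 0 → ‖w‖⁻¹ • w ∈ S := by
    intro w hw hw0
    refine ⟨?_, W.smul_mem _ hw⟩
    simp [norm_smul, hw0]
  -- On the complement `W` the seminorm at `x₀` is a norm; compactness of its unit sphere gives a
  -- positive lower bound `c`, whence `‖w‖ ≤ c⁻¹ p x₀ w` on `W`.
  have h1 : ∀ᶠ c : ℝ in 𝓝 0, ∀ w ∈ S, c < p x₀ w := by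
    refine hScompact.eventually_forall_of_forall_eventually fun w hw => ?_
    have hc : ContinuousAt (fun z : ℝ × (E →L[ℝ] ℝ) => p x₀ z.2 - z.1) (0, w) :=
      (ContinuousAt.comp (f := Prod.snd) (hslice w) continuousAt_snd).sub continuousAt_fst
    have := hc.eventually_const_lt (u := 0) (by simpa using hSpos w hw)
    filter_upwards [this] with z hz using by linarith
  obtain ⟨c, hc, hc0⟩ := ((h1.filter_mono nhdsWithin_le_nhds).and
    (self_mem_nhdsWithin : Ioi (0 : ℝ) ∈ 𝓝[>] 0)).exists
  have hc0 : 0 < c := hc0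
  have hnorm : ∀ w ∈ W, ‖w‖ ≤ p x₀ w * c⁻¹ := by
    intro w hw
    by_cases hw0 : w = 0
    · simp [hw0]
    · have := hc _ (hscale w hw hw0)
      rw [map_smul_eq_mul, norm_inv, norm_norm, inv_mul_eq_div,
        lt_div_iff₀ (norm_pos_iff.2 hw0)] at this
      rw [← div_eq_mul_inv, le_div_iff₀ hc0]
      linarith
  refine ⟨c⁻¹, by positivity, fun k hk => ?_⟩
  have h2 : ∀ᶠ x in 𝓝 x₀, ∀ w ∈ S, p x₀ w < k * p x w := by
    refine hScompact.eventually_forall_of_forall_eventually fun w hw => ?_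
    have hc : ContinuousAt (fun z : X × (E →L[ℝ] ℝ) => k * p z.1 z.2 - p x₀ z.2) (x₀, w) :=
      ((hp w).const_mul k).sub (ContinuousAt.comp (f := Prod.snd) (hslice w) continuousAt_snd)
    have := hc.eventually_const_lt (u := 0) (by
      have := hSpos w hw
      simp only
      nlinarith)
    filter_upwards [this] with z hz using by linarith
  filter_upwards [h2, hdim] with x hx hdimx ξ hξ
  have hle : ∀ w ∈ W, p x₀ w ≤ k * p x w := by
    intro w hw
    by_cases hw0 : w = 0
    · simp [hw0]
    · have := hx _ (hscale w hw hw0)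
      have hn := inv_pos.2 (norm_pos_iff.2 hw0)
      rw [map_smul_eq_mul, map_smul_eq_mul, norm_inv, norm_norm, mul_left_comm] at this
      exact (lt_of_mul_lt_mul_left this hn.le).le
  have hdisj : Disjoint (seminormKer (p x)) W := by
    rw [Submodule.disjoint_def]
    intro w hw1 hw2
    by_contra hw0
    have := hle w hw2
    rw [mem_seminormKer.1 hw1, mul_zero] at this
    exact absurd (hpos w hw2 hw0) (not_lt.2 this)
  -- Constancy of the dimension enters here: disjointness from `W` alone would allow the null space
  -- at `x` to be smaller than at `x₀`.
  have htop : seminormKer (p x) ⊔ W = ⊤ := by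
    refine Submodule.eq_top_of_disjoint _ _ ?_ hdisj
    rw [hdimx, Submodule.finrank_add_eq_of_isCompl hW]
  obtain ⟨z, hz, u, hu, hzu⟩ := Submodule.mem_sup.1 (htop ▸ Submodule.mem_top : ξ ∈ _)
  have hpu : p x u ≤ 1 := by
    have h3 : u = ξ - z := by rw [← hzu]; abel
    have h4 := map_sub_le_add (p x) ξ z
    rw [mem_seminormKer.1 hz, add_zero, ← h3] at h4
    exact h4.trans hξ
  have hpu0 : p x₀ u ≤ k := (hle u hu).trans (by nlinarith)
  refine ⟨u, ?_, hpu0, (hnorm u hu).trans (by gcongr)⟩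
  rw [← hzu, add_sub_cancel_right]
  exact hz

/-- Where the dual norm of `w` is finite, null covectors vanish on `w`, so each test covector can be
replaced by its bounded component in the fixed complement. -/
lemma exists_eventually_polarNorm_eq_top_or_le
    (hp : ∀ ξ, ContinuousAt (fun z : X × (E →L[ℝ] ℝ) => p z.1 z.2) (x₀, ξ))
    (hdim : ∀ᶠ x in 𝓝 x₀, Module.finrank ℝ (seminormKer (p x)) =
      Module.finrank ℝ (seminormKer (p x₀))) :
    ∃ C > 0, ∀ᶠ x in 𝓝 x₀, ∀ w,
      polarNorm (p x) w = ⊤ ∨ polarNorm (p x) w ≤ ENNReal.ofReal (C * ‖w‖) := by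
  obtain ⟨C, hC, h⟩ := exists_complement_of_finrank_seminormKer hp hdim
  refine ⟨2 * C, by positivity, ?_⟩
  filter_upwards [h 2 one_lt_two] with x hx w
  refine or_iff_not_imp_left.2 fun hfin => polarNorm_le_iff.2 fun ξ hξ => ?_
  obtain ⟨u, hu0, -, hu⟩ := hx ξ hξ
  have := apply_eq_zero_of_polarNorm_ne_top hfin hu0
  rw [sub_apply, sub_eq_zero] at this
  rw [this]
  refine ENNReal.ofReal_le_ofReal ((u.le_opNorm w).trans ?_)
  gcongr

lemma eventually_polarNorm_eq_top_or_lt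
    (hp : ∀ ξ, ContinuousAt (fun z : X × (E →L[ℝ] ℝ) => p z.1 z.2) (x₀, ξ))
    (hdim : ∀ᶠ x in 𝓝 x₀, Module.finrank ℝ (seminormKer (p x)) =
      Module.finrank ℝ (seminormKer (p x₀)))
    {w₀ : E} {a : ℝ≥0∞} (ha : polarNorm (p x₀) w₀ < a) :
    ∀ᶠ z : X × E in 𝓝 (x₀, w₀), polarNorm (p z.1) z.2 = ⊤ ∨ polarNorm (p z.1) z.2 < a := by
  obtain ⟨C, hC, h⟩ := exists_complement_of_finrank_seminormKer hp hdim
  have hfin : polarNorm (p x₀) w₀ ≠ ⊤ := ha.ne_top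
  set m := (polarNorm (p x₀) w₀).toReal with hm
  have hm0 : 0 ≤ m := ENNReal.toReal_nonneg
  have hmeq : polarNorm (p x₀) w₀ = ENNReal.ofReal m := (ENNReal.ofReal_toReal hfin).symm
  have hcont : ContinuousAt (fun z : ℝ × E => ENNReal.ofReal (z.1 * m + z.1 * C * ‖z.2 - w₀‖))
      (1, w₀) := by
    refine (ENNReal.continuous_ofReal.comp ?_).continuousAt
    fun_prop
  have hev := hcont.eventually_lt_const (u := a) (by simpa [← hmeq] using ha)
  rw [nhds_prod_eq] at hev
  -- The bound `k m + k C ‖w - w₀‖` tends to `m` as `k → 1` and `w → w₀`. The factor `k > 1` is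
  -- fixed first, because the neighbourhood of `x₀` depends on it.
  obtain ⟨k, hk, hk1⟩ := ((hev.curry.filter_mono nhdsWithin_le_nhds).and
    (self_mem_nhdsWithin : Ioi (1 : ℝ) ∈ 𝓝[>] 1)).exists
  have hk1 : 1 < k := hk1
  filter_upwards [(h k hk1).prod_nhds hk] with z hz
  refine or_iff_not_imp_left.2 fun hzfin => lt_of_le_of_lt (polarNorm_le_iff.2 fun ξ hξ => ?_) hz.2
  obtain ⟨u, hu0, hu1, hu⟩ := hz.1 ξ hξ
  have := apply_eq_zero_of_polarNorm_ne_top hzfin hu0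
  rw [sub_apply, sub_eq_zero] at this
  rw [this]
  refine ENNReal.ofReal_le_ofReal ?_
  have h1 : u z.2 = u w₀ + u (z.2 - w₀) := by rw [← map_add, add_sub_cancel]
  have h2 : |u w₀| ≤ k * m :=
    (abs_apply_le_mul_of_polarNorm_le hm0 hmeq.le u).trans (by gcongr)
  have h3 : |u (z.2 - w₀)| ≤ k * C * ‖z.2 - w₀‖ :=
    (u.le_opNorm _).trans (by gcongr)
  rw [h1]
  exact (abs_add_le _ _).trans (add_le_add h2 h3)

end PolarNorm

/-! ### The fibre seminorm and subunit curves in a chart -/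

namespace FibreSeminorm

variable {n : ℕ} {M : Type*} [TopologicalSpace M] [ChartedSpace (EucSp n) M]
  [IsManifold 𝓘(ℝ, EucSp n) ∞ M]

/-- The derivative of the preferred chart at `x₀`. -/
noncomputable def chartDeriv (x₀ x : M) : TangentSpace 𝓘(ℝ, EucSp n) x →L[ℝ] EucSp n :=
  mfderiv 𝓘(ℝ, EucSp n) 𝓘(ℝ, EucSp n) (chartAt (EucSp n) x₀) x

/-- The pull-back of covectors by the preferred chart at `x₀`. -/
noncomputable def chartPullback (x₀ x : M) : (EucSp n →L[ℝ] ℝ) →ₗ[ℝ] CotangentFibre n M x where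
  toFun ξ := ξ.comp (chartDeriv x₀ x)
  map_add' _ _ := rfl
  map_smul' _ _ := rfl

/-- The fibre seminorm read in the chart at `x₀`. -/
noncomputable def chartSeminorm (P : FibreSeminorm n M) (x₀ x : M) :
    Seminorm ℝ (EucSp n →L[ℝ] ℝ) :=
  (P.seminorm x).comp (chartPullback x₀ x)

lemma chartSeminorm_apply (P : FibreSeminorm n M) (x₀ x : M) (ξ : EucSp n →L[ℝ] ℝ) :
    P.chartSeminorm x₀ x ξ = P.seminorm x (ξ.comp (chartDeriv x₀ x)) := rfl

lemma chartDeriv_eq {x₀ x : M} (hx : x ∈ (chartAt (EucSp n) x₀).source) :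
    (trivializationAt (EucSp n) (TangentSpace 𝓘(ℝ, EucSp n)) x₀).continuousLinearMapAt ℝ x =
      chartDeriv x₀ x := by
  rw [TangentBundle.continuousLinearMapAt_trivializationAt hx]
  rfl

lemma continuousOn_chartSeminorm (P : FibreSeminorm n M) (x₀ : M) :
    ContinuousOn (fun z : M × (EucSp n →L[ℝ] ℝ) => P.chartSeminorm x₀ z.1 z.2)
      ((chartAt (EucSp n) x₀).source ×ˢ univ) := by
  let e := trivializationAt (EucSp n →L[ℝ] ℝ) (CotangentFibre n M) x₀
  have h1 := P.continuous_seminorm.comp_continuousOn e.continuousOn_invFun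
  have h2 : e.target = (chartAt (EucSp n) x₀).source ×ˢ univ := by
    show ((trivializationAt (EucSp n) (TangentSpace 𝓘(ℝ, EucSp n)) x₀).baseSet ∩ univ) ×ˢ univ = _
    rw [inter_univ]; rfl
  rw [h2] at h1
  refine h1.congr ?_
  rintro ⟨x, ξ⟩ ⟨hx, -⟩
  show P.chartSeminorm x₀ x ξ = _
  rw [chartSeminorm_apply]
  -- The trivialisation of the hom bundle conjugates by those of its two factors, and that of the
  -- trivial line bundle is the identity.
  have h3 : e.toPartialEquiv.symm (x, ξ) = ⟨x, ξ.comp (chartDeriv x₀ x)⟩ := by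
    rw [← chartDeriv_eq hx]
    have h4 : e.toPartialEquiv.symm (x, ξ) =
        ⟨x, ((trivializationAt ℝ (Bundle.Trivial M ℝ) x₀).symmL ℝ x).comp (ξ.comp
          ((trivializationAt (EucSp n) (TangentSpace 𝓘(ℝ, EucSp n)) x₀).continuousLinearMapAt
            ℝ x))⟩ := rfl
    rw [h4]
    congr 1
    have h5 : (trivializationAt ℝ (Bundle.Trivial M ℝ) x₀).symmL ℝ x =
        ContinuousLinearMap.id ℝ ℝ := Bundle.Trivial.symmL_trivialization ℝ M ℝ x
    rw [h5]
    rfl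
  exact (congrArg (fun η : Bundle.TotalSpace (EucSp n →L[ℝ] ℝ) (CotangentFibre n M) =>
    P.seminorm η.1 η.2) h3).symm

lemma mdifferentiable_chart_one (x₀ : M) :
    (chartAt (EucSp n) x₀).MDifferentiable 𝓘(ℝ, EucSp n) 𝓘(ℝ, EucSp n) :=
  mdifferentiable_chart x₀

/-- The differential of the preferred chart as an equivalence. -/
noncomputable def chartDerivEquiv {x₀ x : M} (hx : x ∈ (chartAt (EucSp n) x₀).source) :
    TangentSpace 𝓘(ℝ, EucSp n) x ≃L[ℝ] EucSp n :=
  (mdifferentiable_chart_one x₀).mfderiv hx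

lemma chartPullback_bijective {x₀ x : M} (hx : x ∈ (chartAt (EucSp n) x₀).source) :
    Function.Bijective (chartPullback (n := n) x₀ x) := by
  constructor
  · intro ξ η h
    ext w
    have := DFunLike.congr_fun h ((chartDerivEquiv hx).symm w)
    have h1 : chartDeriv x₀ x ((chartDerivEquiv hx).symm w) = w :=
      (chartDerivEquiv hx).apply_symm_apply w
    change ξ (chartDeriv x₀ x ((chartDerivEquiv hx).symm w)) =
      η (chartDeriv x₀ x ((chartDerivEquiv hx).symm w)) at this
    rwa [h1] at this
  · intro ξ
    refine ⟨ξ.comp ((chartDerivEquiv hx).symm : EucSp n →L[ℝ] _), ?_⟩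
    ext v
    exact congrArg ξ ((chartDerivEquiv hx).symm_apply_apply v)

lemma dualNorm_eq_polarNorm (P : FibreSeminorm n M) {x₀ x : M}
    (hx : x ∈ (chartAt (EucSp n) x₀).source) (v : TangentSpace 𝓘(ℝ, EucSp n) x) :
    P.dualNorm x v = polarNorm (P.chartSeminorm x₀ x) (chartDeriv x₀ x v) := by
  refine le_antisymm (iSup_le ?_) (iSup_le ?_)
  · rintro ⟨ξ, hξ⟩
    obtain ⟨η, rfl⟩ := (chartPullback_bijective hx).2 ξ
    exact ofReal_abs_apply_le_polarNorm (p := P.chartSeminorm x₀ x) hξ _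
  · rintro ⟨ξ, hξ⟩
    exact le_iSup (fun ξ : {ξ : CotangentFibre n M x // P.seminorm x ξ ≤ 1} =>
      ENNReal.ofReal |ξ.1 v|) ⟨chartPullback x₀ x ξ, hξ⟩

lemma finrank_seminormKer_chartSeminorm (P : FibreSeminorm n M) {x₀ x : M}
    (hx : x ∈ (chartAt (EucSp n) x₀).source) :
    Module.finrank ℝ (seminormKer (P.chartSeminorm x₀ x)) =
      Module.finrank ℝ (P.zeroSubspace x) := by
  have h : P.zeroSubspace x = (seminormKer (P.chartSeminorm x₀ x)).map
      (LinearEquiv.ofBijective (chartPullback x₀ x) (chartPullback_bijective hx)).toLinearMap := by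
    ext ξ
    rw [Submodule.mem_map]
    constructor
    · intro hξ
      obtain ⟨η, rfl⟩ := (chartPullback_bijective hx).2 ξ
      exact ⟨η, hξ, rfl⟩
    · rintro ⟨η, hη, rfl⟩
      exact hη
  rw [h, LinearEquiv.finrank_map_eq]

lemma continuousAt_chartSeminorm (P : FibreSeminorm n M) {x₀ x : M}
    (hx : x ∈ (chartAt (EucSp n) x₀).source) (ξ : EucSp n →L[ℝ] ℝ) :
    ContinuousAt (fun z : M × (EucSp n →L[ℝ] ℝ) => P.chartSeminorm x₀ z.1 z.2) (x, ξ) :=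
  (P.continuousOn_chartSeminorm x₀).continuousAt
    (((chartAt (EucSp n) x₀).open_source.prod isOpen_univ).mem_nhds ⟨hx, trivial⟩)

/-- The chain rule for a chart and a curve, within a set. -/
lemma hasDerivWithinAt_chart_comp {x₀ : M} {c : ℝ → M} {s : Set ℝ} {t : ℝ}
    (ht : c t ∈ (chartAt (EucSp n) x₀).source)
    (hc : MDifferentiableWithinAt 𝓘(ℝ, ℝ) 𝓘(ℝ, EucSp n) c s t) :
    HasDerivWithinAt (fun t => chartAt (EucSp n) x₀ (c t))
      (chartDeriv x₀ (c t) (mfderivWithin 𝓘(ℝ, ℝ) 𝓘(ℝ, EucSp n) c s t (1 : ℝ))) s t := by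
  have h1 := ((mdifferentiable_chart_one x₀).mdifferentiableAt ht).hasMFDerivAt
  let L : ℝ →L[ℝ] EucSp n :=
    (chartDeriv x₀ (c t)).comp (mfderivWithin 𝓘(ℝ, ℝ) 𝓘(ℝ, EucSp n) c s t)
  have h2 : HasFDerivWithinAt (fun t => chartAt (EucSp n) x₀ (c t)) L s t :=
    (h1.comp_hasMFDerivWithinAt t hc.hasMFDerivWithinAt).hasFDerivWithinAt
  exact h2.hasDerivWithinAt

lemma mdifferentiableAt_of_chart_comp {x₀ : M} {c : ℝ → M} {t : ℝ} (hc : ContinuousAt c t)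
    (ht : c t ∈ (chartAt (EucSp n) x₀).source)
    (hd : DifferentiableAt ℝ (fun t => chartAt (EucSp n) x₀ (c t)) t) :
    MDifferentiableAt 𝓘(ℝ, ℝ) 𝓘(ℝ, EucSp n) c t := by
  have h1 := (mdifferentiable_chart_one x₀).mdifferentiableAt_symm
    ((chartAt (EucSp n) x₀).map_source ht)
  have h2 := h1.comp t hd.mdifferentiableAt
  refine h2.congr_of_eventuallyEq ?_
  filter_upwards [hc.preimage_mem_nhds ((chartAt (EucSp n) x₀).open_source.mem_nhds ht)] with s hs
  exact ((chartAt (EucSp n) x₀).left_inv hs).symm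

lemma absolutelyContinuousOnInterval_clm_comp {E : Type*} [NormedAddCommGroup E] [NormedSpace ℝ E]
    {f : ℝ → E} {a b : ℝ} (hf : AbsolutelyContinuousOnInterval f a b) (ξ : E →L[ℝ] ℝ) :
    AbsolutelyContinuousOnInterval (fun t => ξ (f t)) a b := by
  refine squeeze_zero (fun _ => Finset.sum_nonneg fun _ _ => dist_nonneg)
    (fun E => ?_) (by simpa using Tendsto.const_mul ‖ξ‖ hf)
  rw [Finset.mul_sum]
  exact Finset.sum_le_sum fun i _ => ξ.lipschitz.dist_le_mul _ _

/-- Along a subunit curve a functional read in a chart varies at most at the rate given by its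
seminorm. -/
lemma IsSubunitCurve.abs_apply_chart_sub_le {P : FibreSeminorm n M} {c : ℝ → M} {T : ℝ}
    (hc : P.IsSubunitCurve c 0 T) {x₀ : M} {τ : ℝ} (hτ : τ ∈ Icc 0 T)
    (hsource : MapsTo c (Icc 0 τ) (chartAt (EucSp n) x₀).source) {ξ : EucSp n →L[ℝ] ℝ} {K : ℝ}
    (hK : ∀ t ∈ Icc 0 τ, P.chartSeminorm x₀ (c t) ξ ≤ K) :
    |ξ (chartAt (EucSp n) x₀ (c τ) - chartAt (EucSp n) x₀ (c 0))| ≤ K * τ := by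
  have hac := hc.1.2 _ (chart_mem_atlas (EucSp n) x₀) 0 τ le_rfl hτ.1 hτ.2 hsource
  have hacξ := absolutelyContinuousOnInterval_clm_comp hac ξ
  have hae : ∀ᵐ t, t ∈ uIoc 0 τ →
      ‖deriv (fun t => ξ (chartAt (EucSp n) x₀ (c t))) t‖ ≤ K := by
    have h1 := (ae_restrict_iff' measurableSet_Icc).1 hc.2
    -- Bounded variation gives differentiability almost everywhere, so the `mfderiv` in the subunit
    -- condition is a genuine velocity there.
    have h2 := hac.boundedVariationOn.locallyBoundedVariationOn.ae_differentiableWithinAt_of_mem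
    have h3 : ∀ᵐ t : ℝ, t ≠ τ := by simp [ae_iff, measure_singleton]
    filter_upwards [h1, h2, h3] with t ht1 ht2 ht3 ht
    rw [uIoc_of_le hτ.1] at ht
    rw [uIcc_of_le hτ.1] at ht2
    have htτ : t < τ := lt_of_le_of_ne ht.2 ht3
    have hnhds : Icc 0 τ ∈ 𝓝 t := Icc_mem_nhds ht.1 htτ
    have htI : t ∈ Icc 0 τ := ⟨ht.1.le, ht.2⟩
    have hd := (ht2 htI).differentiableAt hnhds
    have hcont : ContinuousAt c t :=
      (hc.1.1.mono (Icc_subset_Icc_right hτ.2)).continuousAt hnhds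
    have hm := mdifferentiableAt_of_chart_comp hcont (hsource htI) hd
    have hder := hasDerivWithinAt_chart_comp (s := univ) (hsource htI)
      hm.mdifferentiableWithinAt
    rw [hasDerivWithinAt_univ, mfderivWithin_univ] at hder
    have hder2 := ξ.hasFDerivAt.comp_hasDerivAt t hder
    have h4 := ht1 ⟨ht.1.le, ht.2.trans hτ.2⟩
    rw [P.dualNorm_eq_polarNorm (hsource htI), ← ENNReal.ofReal_one] at h4
    have h5 := abs_apply_le_mul_of_polarNorm_le zero_le_one h4 ξ
    rw [mul_one] at h5
    have h6 := hder2.deriv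
    change deriv (fun t => ξ (chartAt (EucSp n) x₀ (c t))) t = _ at h6
    rw [h6]
    exact h5.trans (hK t htI)
  have h := intervalIntegral.norm_integral_le_of_norm_le_const_ae hae
  rw [hacξ.integral_deriv_eq_sub, sub_zero, abs_of_nonneg hτ.1, ← map_sub] at h
  exact h

end FibreSeminorm

/-! ### Lower bounds for the control distance -/

namespace FibreSeminorm

variable {n : ℕ} {M : Type*} [TopologicalSpace M] [ChartedSpace (EucSp n) M]
  [IsManifold 𝓘(ℝ, EucSp n) ∞ M]

/-- Subunit curves starting near a point need a definite time to leave a neighbourhood of it. -/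
lemma exists_forall_mapsTo_of_isSubunitCurve [T2Space M] (P : FibreSeminorm n M) (x₀ : M)
    {U : Set M} (hU : U ∈ 𝓝 x₀) :
    ∃ δ > 0, ∃ V ∈ 𝓝 x₀, ∀ T : ℝ, T < δ → ∀ c : ℝ → M, P.IsSubunitCurve c 0 T → c 0 ∈ V →
      MapsTo c (Icc 0 T) (U ∩ (chartAt (EucSp n) x₀).source) := by
  set e := chartAt (EucSp n) x₀ with he
  have hx₀ : x₀ ∈ e.source := mem_chart_source (EucSp n) x₀
  obtain ⟨C, hC, hbound⟩ := exists_bound_of_continuousAt (P.continuousAt_chartSeminorm hx₀ 0)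
  have hnear := (e.symm.continuousAt (e.map_source hx₀)).preimage_mem_nhds
    (by rw [e.left_inv hx₀]; exact inter_mem hU hbound)
  obtain ⟨ρ, hρ, hball⟩ := Metric.nhds_basis_closedBall.mem_iff.1
    (inter_mem hnear (e.open_target.mem_nhds (e.map_source hx₀)))
  set K := e.symm '' Metric.closedBall (e x₀) ρ with hK
  -- The Hausdorff property ensures that a curve cannot leave the chart domain without passing
  -- through `K`.
  have hKclosed : IsClosed K := ((isCompact_closedBall _ _).image_of_continuousOn
    (e.symm.continuousOn.mono fun y hy => (hball hy).2)).isClosed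
  have hKsource : ∀ x ∈ K, x ∈ e.source := by
    rintro _ ⟨y, hy, rfl⟩
    exact e.map_target (hball hy).2
  have hKU : ∀ x ∈ K, x ∈ U := by
    rintro _ ⟨y, hy, rfl⟩
    exact (hball hy).1.1
  have hKbound : ∀ x ∈ K, ∀ ξ, P.chartSeminorm x₀ x ξ ≤ C * ‖ξ‖ := by
    rintro _ ⟨y, hy, rfl⟩
    exact (hball hy).1.2
  have hopen : ∀ σ, IsOpen (e.source ∩ e ⁻¹' Metric.ball (e x₀) σ) := fun σ =>
    e.isOpen_inter_preimage Metric.isOpen_ball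
  set B := e.source ∩ e ⁻¹' Metric.ball (e x₀) ρ with hB
  have hBK : B ⊆ K := fun x hx =>
    ⟨e x, Metric.ball_subset_closedBall hx.2, e.left_inv hx.1⟩
  -- Inside `K` the chart speed is at most `C`, so a curve starting within `ρ / 2` of the centre
  -- moves less than `ρ / 2` in time less than `ρ / (2 C)`. The first exit time `τ` would contradict
  -- this.
  refine ⟨ρ / (2 * C), by positivity, e.source ∩ e ⁻¹' Metric.ball (e x₀) (ρ / 2),
    (hopen _).mem_nhds ⟨hx₀, Metric.mem_ball_self (by positivity)⟩, fun T hT c hc hc0 => ?_⟩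
  have hmain : ∀ t ∈ Icc 0 T, c t ∈ B := by
    by_contra! hcon
    set A := Icc 0 T ∩ c ⁻¹' Bᶜ with hA
    have hAclosed : IsClosed A :=
      hc.1.1.preimage_isClosed_of_isClosed isClosed_Icc (hopen ρ).isClosed_compl
    have hAbdd : BddBelow A := ⟨0, fun t ht => ht.1.1⟩
    obtain ⟨hτ, hτB⟩ : sInf A ∈ A := hAclosed.csInf_mem
      (by obtain ⟨t, ht, htB⟩ := hcon; exact ⟨t, ht, htB⟩) hAbdd
    set τ := sInf A with hτdef
    have hlt : ∀ t ∈ Ico 0 τ, c t ∈ B := by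
      intro t ht
      by_contra h
      exact (csInf_le hAbdd ⟨⟨ht.1, ht.2.le.trans hτ.2⟩, h⟩).not_gt ht.2
    have hτ0 : 0 < τ := by
      refine lt_of_le_of_ne hτ.1 fun h => hτB ?_
      rw [← h]
      exact ⟨hc0.1, Metric.ball_subset_ball (by linarith) hc0.2⟩
    have hτK : c τ ∈ K := by
      have h1 : Tendsto c (𝓝[Ico 0 τ] τ) (𝓝 (c τ)) :=
        ((hc.1.1 τ hτ).mono fun t ht => ⟨ht.1, ht.2.le.trans hτ.2⟩)
      have h2 : (𝓝[Ico 0 τ] τ).NeBot := by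
        rw [← mem_closure_iff_nhdsWithin_neBot, closure_Ico hτ0.ne]
        exact ⟨hτ0.le, le_rfl⟩
      refine hKclosed.mem_of_tendsto h1 ?_
      filter_upwards [self_mem_nhdsWithin] with t ht using hBK (hlt t ht)
    have hIK : ∀ t ∈ Icc 0 τ, c t ∈ K := by
      intro t ht
      rcases ht.2.eq_or_lt with h | h
      · rwa [h]
      · exact hBK (hlt t ⟨ht.1, h⟩)
    obtain ⟨g, hg, hgv⟩ := exists_dual_vector'' ℝ (e (c τ) - e (c 0))
    have hvar := hc.abs_apply_chart_sub_le hτ (fun t ht => hKsource _ (hIK t ht))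
      (ξ := g) (K := C) fun t ht => (hKbound _ (hIK t ht) g).trans (by nlinarith)
    rw [← he, hgv] at hvar
    have h3 : dist (e (c τ)) (e (c 0)) ≤ C * τ := by
      rw [dist_eq_norm]
      simpa using hvar
    have h4 : C * τ < ρ / 2 := by
      have : τ < ρ / (2 * C) := hτ.2.trans_lt hT
      rw [lt_div_iff₀ (by positivity)] at this
      linarith
    refine hτB ⟨hKsource _ hτK, ?_⟩
    have h5 : dist (e (c 0)) (e x₀) < ρ / 2 := hc0.2
    have h6 := dist_triangle (e (c τ)) (e (c 0)) (e x₀)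
    exact Metric.mem_ball.2 (by linarith)
  exact fun t ht => ⟨hKU _ (hBK (hmain t ht)), (hmain t ht).1⟩

/-- The dual norm of the velocity of a curve on `[a, b]`. -/
noncomputable def speed (P : FibreSeminorm n M) (γ : ℝ → M) (a b t : ℝ) : ℝ≥0∞ :=
  P.dualNorm (γ t) (mfderivWithin 𝓘(ℝ, ℝ) 𝓘(ℝ, EucSp n) γ (Icc a b) t (1 : ℝ))

/-- The velocity of a curve on `[a, b]`, read in the preferred chart at `x₀`. -/
noncomputable def chartVelocity (x₀ : M) (γ : ℝ → M) (a b t : ℝ) : EucSp n :=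
  chartDeriv x₀ (γ t) (mfderivWithin 𝓘(ℝ, ℝ) 𝓘(ℝ, EucSp n) γ (Icc a b) t (1 : ℝ))

lemma speed_eq (P : FibreSeminorm n M) {x₀ : M} {γ : ℝ → M} {a b t : ℝ}
    (ht : γ t ∈ (chartAt (EucSp n) x₀).source) :
    P.speed γ a b t = polarNorm (P.chartSeminorm x₀ (γ t)) (chartVelocity x₀ γ a b t) :=
  P.dualNorm_eq_polarNorm ht _

lemma hasDerivWithinAt_chartVelocity {x₀ : M} {γ : ℝ → M} {a b t : ℝ} (ht : t ∈ Icc a b)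
    (hγ : ContMDiffOn 𝓘(ℝ, ℝ) 𝓘(ℝ, EucSp n) 1 γ (Icc a b))
    (hs : γ t ∈ (chartAt (EucSp n) x₀).source) :
    HasDerivWithinAt (fun t => chartAt (EucSp n) x₀ (γ t)) (chartVelocity x₀ γ a b t)
      (Icc a b) t :=
  hasDerivWithinAt_chart_comp hs ((hγ t ht).mdifferentiableWithinAt one_ne_zero)

lemma continuousWithinAt_chartVelocity {x₀ : M} {γ : ℝ → M} {a b t : ℝ} (hab : a < b)
    (ht : t ∈ Icc a b) (hγ : ContMDiffOn 𝓘(ℝ, ℝ) 𝓘(ℝ, EucSp n) 1 γ (Icc a b))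
    (hs : γ t ∈ (chartAt (EucSp n) x₀).source) :
    ContinuousWithinAt (chartVelocity (n := n) x₀ γ a b) (Icc a b) t := by
  have h1 : ContDiffWithinAt ℝ 1 (fun t => chartAt (EucSp n) x₀ (γ t)) (Icc a b) t := by
    rw [← contMDiffWithinAt_iff_contDiffWithinAt]
    exact ContMDiffAt.comp_contMDiffWithinAt t (contMDiffAt_of_mem_maximalAtlas
      (IsManifold.chart_mem_maximalAtlas x₀) hs) (hγ t ht)
  have h2 := (h1.fderivWithin_right (uniqueDiffOn_Icc hab) (m := 0) (by simp) ht).continuousWithinAt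
  have h3 : ContinuousWithinAt
      (derivWithin (fun t => chartAt (EucSp n) x₀ (γ t)) (Icc a b)) (Icc a b) t :=
    h2.clm_apply continuousWithinAt_const
  refine h3.congr_of_eventuallyEq_of_mem ?_ ht
  filter_upwards [self_mem_nhdsWithin, (hγ.continuousOn t ht).preimage_mem_nhdsWithin
    ((chartAt (EucSp n) x₀).open_source.mem_nhds hs)] with s hsI hss
  exact ((hasDerivWithinAt_chartVelocity hsI hγ hss).derivWithin (uniqueDiffOn_Icc hab s hsI)).symm

/-- Locally along a `C¹` curve the control distance is at least `k` times the parameter distance if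
`k` is below the speed. -/
lemma exists_forall_ofReal_mul_le_controlDist [T2Space M] (P : FibreSeminorm n M) {γ : ℝ → M}
    {a b : ℝ} (hab : a < b) (hγ : ContMDiffOn 𝓘(ℝ, ℝ) 𝓘(ℝ, EucSp n) 1 γ (Icc a b))
    {t₀ : ℝ} (ht₀ : t₀ ∈ Icc a b) {k : ℝ} (hk : k ≤ 0 ∨ ENNReal.ofReal k < P.speed γ a b t₀) :
    ∃ r > 0, ∀ s ∈ Icc a b ∩ Metric.ball t₀ r, ∀ t ∈ Icc a b ∩ Metric.ball t₀ r, s ≤ t →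
      ENNReal.ofReal (k * (t - s)) ≤ P.controlDist (γ s) (γ t) := by
  rcases hk with hk | hk
  · refine ⟨1, one_pos, fun s _ t _ hst => ?_⟩
    rw [ENNReal.ofReal_of_nonpos (mul_nonpos_of_nonpos_of_nonneg hk (sub_nonneg.2 hst))]
    exact zero_le
  set x₀ := γ t₀ with hx₀
  set e := chartAt (EucSp n) x₀ with he
  have hx₀s : γ t₀ ∈ e.source := mem_chart_source (EucSp n) x₀
  rw [P.speed_eq hx₀s] at hk
  obtain ⟨ξ, hξ, hlt⟩ := exists_lt_apply_of_lt_polarNorm hk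
  have hlt := (ENNReal.ofReal_lt_ofReal_iff'.1 hlt).1
  have hU : {x | P.chartSeminorm x₀ x ξ ≤ 1} ∈ 𝓝 x₀ := by
    have : ContinuousAt (fun x => P.chartSeminorm x₀ x ξ) x₀ :=
      ContinuousAt.comp (f := fun x => (x, ξ)) (P.continuousAt_chartSeminorm hx₀s ξ) (by fun_prop)
    filter_upwards [this.eventually_lt_const hξ] with x hx using hx.le
  obtain ⟨δ, hδ, V, hV, hconf⟩ := P.exists_forall_mapsTo_of_isSubunitCurve x₀ hU
  have hvel : ∀ᶠ t in 𝓝[Icc a b] t₀, k < ξ (chartVelocity x₀ γ a b t) :=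
    (ξ.continuous.continuousAt.comp_continuousWithinAt
      (continuousWithinAt_chartVelocity hab ht₀ hγ hx₀s)).eventually_const_lt hlt
  have hev := (hvel.and ((hγ.continuousOn t₀ ht₀).preimage_mem_nhdsWithin hV)).and
    ((hγ.continuousOn t₀ ht₀).preimage_mem_nhdsWithin (e.open_source.mem_nhds hx₀s))
  obtain ⟨r, hr, hev⟩ := Metric.mem_nhdsWithin_iff.1 hev
  -- Parameters in this ball differ by at most `2 r'`, so `k (t - s) ≤ δ`. Curves taking time `T ≥
  -- δ`, which may leave the chart, then satisfy the bound trivially.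
  set r' := min r (δ / (2 * (|k| + 1))) with hr'
  have hr'pos : 0 < r' := lt_min hr (by positivity)
  have hev' : ∀ t ∈ Icc a b ∩ Metric.ball t₀ r', (k < ξ (chartVelocity x₀ γ a b t) ∧ γ t ∈ V) ∧
      γ t ∈ e.source := fun t ht =>
    hev ⟨Metric.ball_subset_ball (min_le_left _ _) ht.2, ht.1⟩
  refine ⟨r', hr'pos, fun s hs t ht hst => le_iInf₂ ?_⟩
  rintro T ⟨hT, c, hc, hc0, hcT⟩
  refine ENNReal.ofReal_le_ofReal ?_
  rcases lt_or_ge T δ with hTδ | hTδ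
  · have hmaps := hconf T hTδ c hc (by rw [hc0]; exact (hev' s hs).1.2)
    have h1 := hc.abs_apply_chart_sub_le (right_mem_Icc.2 hT.le) (x₀ := x₀)
      (fun t ht => (hmaps ht).2) (ξ := ξ) (K := 1) (fun t ht => (hmaps ht).1)
    rw [hc0, hcT, one_mul] at h1
    refine le_trans ?_ ((le_abs_self _).trans h1)
    rw [map_sub]
    have hconv : Convex ℝ (Icc a b ∩ Metric.ball t₀ r') :=
      (convex_Icc a b).inter (convex_ball _ _)
    have hder : ∀ τ ∈ Icc a b ∩ Metric.ball t₀ r', HasDerivWithinAt (fun t => ξ (e (γ t)))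
        (ξ (chartVelocity x₀ γ a b τ)) (Icc a b) τ := fun τ hτ =>
      ξ.hasFDerivAt.comp_hasDerivWithinAt τ
        (hasDerivWithinAt_chartVelocity hτ.1 hγ (hev' τ hτ).2)
    have hder' : ∀ τ ∈ interior (Icc a b ∩ Metric.ball t₀ r'), HasDerivAt (fun t => ξ (e (γ t)))
        (ξ (chartVelocity x₀ γ a b τ)) τ := fun τ hτ =>
      (hder τ (interior_subset hτ)).hasDerivAt
        (mem_of_superset (isOpen_interior.mem_nhds hτ) (interior_subset.trans inter_subset_left))
    exact hconv.mul_sub_le_image_sub_of_le_deriv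
      (fun τ hτ => (hder τ hτ).continuousWithinAt.mono inter_subset_left)
      (fun τ hτ => (hder' τ hτ).differentiableAt.differentiableWithinAt)
      (fun τ hτ => by rw [(hder' τ hτ).deriv]; exact (hev' τ (interior_subset hτ)).1.1.le)
      s hs t ht hst
  · have h1 := Metric.mem_ball.1 hs.2
    have h2 := Metric.mem_ball.1 ht.2
    rw [Real.dist_eq] at h1 h2
    have h3 : t - s ≤ 2 * r' := by
      have := abs_lt.1 h1
      have := abs_lt.1 h2
      linarith
    have h4 : r' ≤ δ / (2 * (|k| + 1)) := min_le_right _ _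
    rw [le_div_iff₀ (by positivity)] at h4
    calc k * (t - s) ≤ |k| * (t - s) :=
          mul_le_mul_of_nonneg_right (le_abs_self k) (sub_nonneg.2 hst)
      _ ≤ |k| * (2 * r') := mul_le_mul_of_nonneg_left h3 (abs_nonneg k)
      _ ≤ r' * (2 * (|k| + 1)) := by nlinarith
      _ ≤ T := h4.trans hTδ

end FibreSeminorm

/-! ### Length versus integrated speed, and continuity of the speed -/

namespace FibreSeminorm

variable {n : ℕ} {M : Type*} [TopologicalSpace M] [ChartedSpace (EucSp n) M]
  [IsManifold 𝓘(ℝ, EucSp n) ∞ M]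

/-- The local bound with `k = g t₀` is integrated over pieces shorter than a Lebesgue number; `ε`
absorbs the oscillation of `g` near `t₀`. -/
lemma ofReal_integral_sub_le_curveLength [T2Space M] (P : FibreSeminorm n M) {γ : ℝ → M}
    {a b : ℝ} (hab : a < b) (hγ : ContMDiffOn 𝓘(ℝ, ℝ) 𝓘(ℝ, EucSp n) 1 γ (Icc a b))
    {g : ℝ → ℝ} (hg : ContinuousOn g (Icc a b))
    (hgs : ∀ t ∈ Icc a b, g t ≤ 0 ∨ ENNReal.ofReal (g t) < P.speed γ a b t) {ε : ℝ} (hε : 0 < ε) :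
    ENNReal.ofReal (∫ t in a..b, (g t - ε)) ≤ P.curveLength γ a b := by
  have hgε : ContinuousOn (fun t => g t - ε) (Icc a b) := hg.sub continuousOn_const
  have hint : ∀ s ∈ Icc a b, ∀ t ∈ Icc a b, IntervalIntegrable (fun t => g t - ε) volume s t :=
    fun s hs t ht => (hgε.mono (ordConnected_Icc.uIcc_subset hs ht)).intervalIntegrable
  have hlocal : ∀ t₀ : Icc a b, ∃ r > 0, ∀ s ∈ Icc a b ∩ Metric.ball t₀.1 r,
      ∀ t ∈ Icc a b ∩ Metric.ball t₀.1 r, s ≤ t →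
        ENNReal.ofReal (∫ τ in s..t, (g τ - ε)) ≤ P.controlDist (γ s) (γ t) := by
    rintro ⟨t₀, ht₀⟩
    obtain ⟨r, hr, h⟩ := P.exists_forall_ofReal_mul_le_controlDist hab hγ ht₀ (hgs t₀ ht₀)
    obtain ⟨r', hr', h'⟩ := Metric.mem_nhdsWithin_iff.1
      ((hg t₀ ht₀).eventually_lt_const (lt_add_of_pos_right (g t₀) hε))
    refine ⟨min r r', lt_min hr hr', fun s hs t ht hst => ?_⟩
    refine le_trans (ENNReal.ofReal_le_ofReal ?_)
      (h s ⟨hs.1, Metric.ball_subset_ball (min_le_left _ _) hs.2⟩ t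
        ⟨ht.1, Metric.ball_subset_ball (min_le_left _ _) ht.2⟩ hst)
    have hsub : Icc s t ⊆ Icc a b ∩ Metric.ball t₀ (min r r') :=
      (ordConnected_Icc.inter (convex_ball _ _).ordConnected).out hs ht
    calc ∫ τ in s..t, (g τ - ε) ≤ ∫ _ in s..t, g t₀ := by
          refine intervalIntegral.integral_mono_on hst (hint s hs.1 t ht.1) (by simp)
            fun τ hτ => ?_
          have h1 := hsub hτ
          have h2 : g τ < g t₀ + ε :=
            h' ⟨Metric.ball_subset_ball (min_le_right _ _) h1.2, h1.1⟩
          linarith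
      _ = g t₀ * (t - s) := by rw [intervalIntegral.integral_const, smul_eq_mul, mul_comm]
  choose r hr hloc using hlocal
  obtain ⟨δ, hδ, hleb⟩ := lebesgue_number_lemma_of_metric (s := Icc a b)
    (c := fun t₀ : Icc a b => Metric.ball t₀.1 (r t₀)) isCompact_Icc
    (fun _ => Metric.isOpen_ball)
    (fun t ht => mem_iUnion.2 ⟨⟨t, ht⟩, Metric.mem_ball_self (hr _)⟩)
  obtain ⟨m, hm⟩ := exists_nat_gt ((b - a) / δ)
  have hba : 0 < b - a := sub_pos.2 hab
  have hm0 : (0 : ℝ) < m := lt_trans (by positivity) hm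
  -- The minimum freezes the uniform subdivision at `b` after step `m`, keeping it within `[a, b]`
  -- for all indices.
  set p : ℕ → ℝ := fun j => a + (b - a) / m * (min j m : ℕ) with hp
  have hstep : 0 < (b - a) / m := by positivity
  have hmono : Monotone p := by
    intro i j hij
    simp only [hp]
    gcongr
  have hp0 : p 0 = a := by simp [hp]
  have hpm : p m = b := by
    simp only [hp, min_self]
    field_simp
    ring
  have hpI : ∀ j, p j ∈ Icc a b := by
    intro j
    refine ⟨hp0 ▸ hmono (Nat.zero_le j), ?_⟩
    have : p j = p (min j m) := by simp [hp]
    rw [this]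
    exact hpm ▸ hmono (min_le_right j m)
  have hdist : ∀ j, p (j + 1) - p j < δ := by
    intro j
    have h1 : ((min (j + 1) m : ℕ) : ℝ) ≤ (min j m : ℕ) + 1 := by
      exact_mod_cast (by omega : min (j + 1) m ≤ min j m + 1)
    have h2 : (b - a) / m < δ := by
      rw [div_lt_iff₀ hδ] at hm
      rw [div_lt_iff₀ hm0]
      linarith
    simp only [hp]
    nlinarith
  calc ENNReal.ofReal (∫ t in a..b, (g t - ε))
      = ENNReal.ofReal (∑ j ∈ Finset.range m, ∫ t in (p j)..(p (j + 1)), (g t - ε)) := by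
        rw [intervalIntegral.sum_integral_adjacent_intervals
          fun j _ => hint _ (hpI j) _ (hpI (j + 1)), hp0, hpm]
    _ ≤ ∑ j ∈ Finset.range m, ENNReal.ofReal (∫ t in (p j)..(p (j + 1)), (g t - ε)) :=
        Finset.le_sum_of_subadditive _ ENNReal.ofReal_zero.le (fun _ _ => ENNReal.ofReal_add_le) _ _
    _ ≤ ∑ j ∈ Finset.range m, P.controlDist (γ (p j)) (γ (p (j + 1))) := by
        refine Finset.sum_le_sum fun j _ => ?_
        obtain ⟨t₀, ht₀⟩ := hleb (p j) (hpI j)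
        refine hloc t₀ _ ⟨hpI j, ht₀ (Metric.mem_ball_self hδ)⟩ _ ⟨hpI (j + 1), ht₀ ?_⟩
          (hmono j.le_succ)
        rw [Metric.mem_ball, Real.dist_eq, abs_of_nonneg (sub_nonneg.2 (hmono j.le_succ))]
        exact hdist j
    _ ≤ P.curveLength γ a b :=
        le_iSup (fun p : {p : ℕ × (ℕ → ℝ) // Monotone p.2 ∧ p.2 0 = a ∧ p.2 p.1 = b} =>
          ∑ j ∈ Finset.range p.1.1, P.controlDist (γ (p.1.2 j)) (γ (p.1.2 (j + 1))))
          ⟨(m, p), hmono, hp0, hpm⟩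

/-- The integral of a continuous function below the speed is a lower bound for the length. -/
lemma ofReal_integral_le_curveLength [T2Space M] (P : FibreSeminorm n M) {γ : ℝ → M}
    {a b : ℝ} (hab : a < b) (hγ : ContMDiffOn 𝓘(ℝ, ℝ) 𝓘(ℝ, EucSp n) 1 γ (Icc a b))
    {g : ℝ → ℝ} (hg : ContinuousOn g (Icc a b))
    (hgs : ∀ t ∈ Icc a b, g t ≤ 0 ∨ ENNReal.ofReal (g t) < P.speed γ a b t) :
    ENNReal.ofReal (∫ t in a..b, g t) ≤ P.curveLength γ a b := by
  have hint : IntervalIntegrable g volume a b :=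
    (hg.mono (uIcc_of_le hab.le).subset).intervalIntegrable
  have hlim : Tendsto (fun ε : ℝ => ENNReal.ofReal ((∫ t in a..b, g t) - (b - a) * ε)) (𝓝[>] 0)
      (𝓝 (ENNReal.ofReal (∫ t in a..b, g t))) := by
    have : Continuous fun ε : ℝ => ENNReal.ofReal ((∫ t in a..b, g t) - (b - a) * ε) :=
      ENNReal.continuous_ofReal.comp (by fun_prop)
    simpa using (this.tendsto 0).mono_left nhdsWithin_le_nhds
  refine le_of_tendsto hlim ?_
  filter_upwards [self_mem_nhdsWithin] with ε hε
  have := P.ofReal_integral_sub_le_curveLength hab hγ hg hgs hε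
  rwa [intervalIntegral.integral_sub hint (by simp), intervalIntegral.integral_const,
    smul_eq_mul] at this

section ConstantRank

variable (P : FibreSeminorm n M)

lemma eventually_finrank_chartSeminorm_eq
    (hdim : Continuous (fun x : M => Module.finrank ℝ (P.zeroSubspace x))) (x₀ : M) :
    ∀ᶠ x in 𝓝 x₀, Module.finrank ℝ (seminormKer (P.chartSeminorm x₀ x)) =
      Module.finrank ℝ (seminormKer (P.chartSeminorm x₀ x₀)) := by
  have h1 : ∀ᶠ x in 𝓝 x₀,
      Module.finrank ℝ (P.zeroSubspace x) = Module.finrank ℝ (P.zeroSubspace x₀) :=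
    hdim.continuousAt.preimage_mem_nhds
      ((isOpen_discrete {Module.finrank ℝ (P.zeroSubspace x₀)}).mem_nhds rfl)
  filter_upwards [h1, (chartAt (EucSp n) x₀).open_source.mem_nhds (mem_chart_source _ x₀)]
    with x hx hxs
  rw [P.finrank_seminormKer_chartSeminorm hxs,
    P.finrank_seminormKer_chartSeminorm (mem_chart_source _ x₀), hx]

variable {γ : ℝ → M} {a b t₀ : ℝ}

lemma tendsto_chartVelocity (hab : a < b)
    (hγ : ContMDiffOn 𝓘(ℝ, ℝ) 𝓘(ℝ, EucSp n) 1 γ (Icc a b)) (ht₀ : t₀ ∈ Icc a b) :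
    Tendsto (fun t => (γ t, chartVelocity (n := n) (γ t₀) γ a b t)) (𝓝[Icc a b] t₀)
      (𝓝 (γ t₀, chartVelocity (n := n) (γ t₀) γ a b t₀)) :=
  (hγ.continuousOn t₀ ht₀).prodMk_nhds
    (continuousWithinAt_chartVelocity hab ht₀ hγ (mem_chart_source _ _))

lemma eventually_speed_eq (hγ : ContMDiffOn 𝓘(ℝ, ℝ) 𝓘(ℝ, EucSp n) 1 γ (Icc a b))
    (ht₀ : t₀ ∈ Icc a b) :
    ∀ᶠ t in 𝓝[Icc a b] t₀, P.speed γ a b t =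
      polarNorm (P.chartSeminorm (γ t₀) (γ t)) (chartVelocity (n := n) (γ t₀) γ a b t) := by
  filter_upwards [(hγ.continuousOn t₀ ht₀).preimage_mem_nhdsWithin
    ((chartAt (EucSp n) (γ t₀)).open_source.mem_nhds (mem_chart_source _ _))] with t ht
  exact P.speed_eq ht

lemma eventually_lt_speed (hab : a < b)
    (hγ : ContMDiffOn 𝓘(ℝ, ℝ) 𝓘(ℝ, EucSp n) 1 γ (Icc a b)) (ht₀ : t₀ ∈ Icc a b)
    {k : ℝ≥0∞} (hk : k < P.speed γ a b t₀) : ∀ᶠ t in 𝓝[Icc a b] t₀, k < P.speed γ a b t := by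
  rw [P.speed_eq (mem_chart_source (EucSp n) (γ t₀))] at hk
  have h := (tendsto_chartVelocity hab hγ ht₀).eventually (eventually_lt_polarNorm
    (P.continuousAt_chartSeminorm (mem_chart_source (EucSp n) (γ t₀))) hk)
  filter_upwards [h, P.eventually_speed_eq hγ ht₀] with t ht hts
  rwa [hts]

/-- By lower semicontinuity the speed near `t₀` exceeds the bound that every finite nearby value
obeys. -/
lemma eventually_speed_eq_top
    (hdim : Continuous (fun x : M => Module.finrank ℝ (P.zeroSubspace x))) (hab : a < b)
    (hγ : ContMDiffOn 𝓘(ℝ, ℝ) 𝓘(ℝ, EucSp n) 1 γ (Icc a b)) (ht₀ : t₀ ∈ Icc a b)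
    (htop : P.speed γ a b t₀ = ⊤) : ∀ᶠ t in 𝓝[Icc a b] t₀, P.speed γ a b t = ⊤ := by
  obtain ⟨C, hC, hev⟩ := exists_eventually_polarNorm_eq_top_or_le
    (P.continuousAt_chartSeminorm (mem_chart_source (EucSp n) (γ t₀)))
    (P.eventually_finrank_chartSeminorm_eq hdim (γ t₀))
  set v := chartVelocity (n := n) (γ t₀) γ a b with hv
  have h1 : ∀ᶠ t in 𝓝[Icc a b] t₀, C * ‖v t‖ < C * ‖v t₀‖ + 1 :=
    ((continuousWithinAt_chartVelocity hab ht₀ hγ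
      (mem_chart_source _ _)).norm.const_mul C).eventually_lt_const (lt_add_one _)
  filter_upwards [P.eventually_speed_eq hγ ht₀, h1,
    (hγ.continuousOn t₀ ht₀).eventually hev,
    P.eventually_lt_speed hab hγ ht₀ (k := ENNReal.ofReal (C * ‖v t₀‖ + 1))
      (htop ▸ ENNReal.ofReal_lt_top)] with t ht1 ht2 ht3 ht4
  rw [ht1] at ht4 ⊢
  refine (ht3 _).resolve_right fun h => ?_
  exact (ht4.trans_le h).not_ge (ENNReal.ofReal_le_ofReal ht2.le)

lemma speed_ne_top_of_curveLength_ne_top [T2Space M]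
    (hdim : Continuous (fun x : M => Module.finrank ℝ (P.zeroSubspace x))) (hab : a < b)
    (hγ : ContMDiffOn 𝓘(ℝ, ℝ) 𝓘(ℝ, EucSp n) 1 γ (Icc a b)) (hL : P.curveLength γ a b ≠ ⊤)
    (ht₀ : t₀ ∈ Icc a b) : P.speed γ a b t₀ ≠ ⊤ := by
  intro htop
  obtain ⟨r, hr, h⟩ := Metric.mem_nhdsWithin_iff.1
    (P.eventually_speed_eq_top hdim hab hγ ht₀ htop)
  set φ : ℝ → ℝ := fun t => max 0 (r - |t - t₀|) with hφ
  have hφc : Continuous φ := by fun_prop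
  have hI : 0 < ∫ t in a..b, φ t :=
    intervalIntegral.integral_pos hab hφc.continuousOn (fun t _ => le_max_left _ _)
      ⟨t₀, ht₀, by simpa [hφ] using hr⟩
  set I := ∫ t in a..b, φ t with hIdef
  -- The bump `φ` lives where the speed is infinite, so any multiple of it is admissible; this `N`
  -- makes the integral the length plus `I`.
  set N := (P.curveLength γ a b).toReal / I + 1 with hN
  have h1 := P.ofReal_integral_le_curveLength hab hγ (g := fun t => N * φ t)
    (hφc.const_mul N).continuousOn (by
      intro t ht
      rcases lt_or_ge (dist t t₀) r with hlt | hge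
      · right
        have : P.speed γ a b t = ⊤ := h ⟨hlt, ht⟩
        rw [this]
        exact ENNReal.ofReal_lt_top
      · left
        have : φ t = 0 := max_eq_left (by rw [Real.dist_eq] at hge; linarith)
        rw [this, mul_zero])
  rw [intervalIntegral.integral_const_mul, ENNReal.ofReal_le_iff_le_toReal hL, ← hIdef, hN,
    add_mul, div_mul_cancel₀ _ hI.ne'] at h1
  linarith

lemma continuousOn_toReal_speed [T2Space M]
    (hdim : Continuous (fun x : M => Module.finrank ℝ (P.zeroSubspace x))) (hab : a < b)
    (hγ : ContMDiffOn 𝓘(ℝ, ℝ) 𝓘(ℝ, EucSp n) 1 γ (Icc a b)) (hL : P.curveLength γ a b ≠ ⊤) :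
    ContinuousOn (fun t => (P.speed γ a b t).toReal) (Icc a b) := by
  intro t₀ ht₀
  have hfin := P.speed_ne_top_of_curveLength_ne_top hdim hab hγ hL ht₀
  refine (ENNReal.tendsto_toReal hfin).comp (tendsto_order.2 ⟨fun k hk => ?_, fun k hk => ?_⟩)
  · exact P.eventually_lt_speed hab hγ ht₀ hk
  · rw [P.speed_eq (mem_chart_source (EucSp n) (γ t₀))] at hk
    have h := (tendsto_chartVelocity hab hγ ht₀).eventually (eventually_polarNorm_eq_top_or_lt
      (P.continuousAt_chartSeminorm (mem_chart_source (EucSp n) (γ t₀)))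
      (P.eventually_finrank_chartSeminorm_eq hdim (γ t₀)) hk)
    filter_upwards [h, P.eventually_speed_eq hγ ht₀, self_mem_nhdsWithin] with t ht hts htI
    have := P.speed_ne_top_of_curveLength_ne_top hdim hab hγ hL htI
    rw [hts] at this ⊢
    exact ht.resolve_left this

end ConstantRank

end FibreSeminorm

/-! ### Reparametrised subunit curves and upper bounds for the length -/

/-- Absolute continuity is preserved by translations and reflections of the parameter. -/
lemma AbsolutelyContinuousOnInterval.comp_affine {X : Type*} [PseudoMetricSpace X] {f : ℝ → X}
    {u κ c d : ℝ} (hκ : κ = 1 ∨ κ = -1)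
    (hf : AbsolutelyContinuousOnInterval f (u + κ * c) (u + κ * d)) :
    AbsolutelyContinuousOnInterval (fun t => f (u + κ * t)) c d := by
  rw [absolutelyContinuousOnInterval_iff] at hf ⊢
  intro ε hε
  obtain ⟨δ, hδ, h⟩ := hf ε hε
  refine ⟨δ, hδ, ?_⟩
  rintro ⟨m, I⟩ ⟨hI1, hI2⟩ hlen
  refine h (m, fun i => (u + κ * (I i).1, u + κ * (I i).2)) ⟨fun i hi => ?_, ?_⟩ ?_
  · obtain ⟨h1, h2⟩ := hI1 i hi
    simp only [mem_uIcc] at h1 h2 ⊢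
    rcases hκ with rfl | rfl
    · constructor
      · rcases h1 with h1 | h1
        · left; constructor <;> linarith
        · right; constructor <;> linarith
      · rcases h2 with h2 | h2
        · left; constructor <;> linarith
        · right; constructor <;> linarith
    · constructor
      · rcases h1 with h1 | h1
        · right; constructor <;> linarith
        · left; constructor <;> linarith
      · rcases h2 with h2 | h2
        · right; constructor <;> linarith
        · left; constructor <;> linarith
  · intro i hi j hj hij
    have h1 := hI2 hi hj hij
    simp only [Function.onFun, uIoc, Ioc_disjoint_Ioc] at h1 ⊢
    rcases hκ with rfl | rfl
    · simpa only [one_mul, min_add_add_left, max_add_add_left, add_le_add_iff_left] using h1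
    · simpa only [neg_one_mul, min_add_add_left, max_add_add_left, add_le_add_iff_left,
        min_neg_neg, max_neg_neg, neg_le_neg_iff] using h1
  · refine lt_of_eq_of_lt (Finset.sum_congr rfl fun i _ => ?_) hlen
    rw [dist_add_left, Real.dist_eq, Real.dist_eq, ← mul_sub, abs_mul]
    rcases hκ with rfl | rfl <;> simp

lemma measurePreserving_affine {κ : ℝ} (hκ : κ = 1 ∨ κ = -1) (u : ℝ) :
    MeasurePreserving (fun t : ℝ => u + κ * t) volume volume := by
  rcases hκ with rfl | rfl
  · simpa using measurePreserving_add_left volume u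
  · simpa [← sub_eq_add_neg] using (Measure.measurePreserving_sub_left volume u)

lemma mfderiv_comp_hasDerivAt {n : ℕ} {M : Type*} [TopologicalSpace M]
    [ChartedSpace (EucSp n) M] {c : ℝ → M} {σ : ℝ → ℝ} {t k : ℝ}
    (hm : MDifferentiableAt 𝓘(ℝ, ℝ) 𝓘(ℝ, EucSp n) c (σ t)) (hσ : HasDerivAt σ k t) :
    mfderiv 𝓘(ℝ, ℝ) 𝓘(ℝ, EucSp n) (c ∘ σ) t (1 : ℝ) =
      k • (mfderiv 𝓘(ℝ, ℝ) 𝓘(ℝ, EucSp n) c (σ t) (1 : ℝ)) := by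
  have h := (hm.hasMFDerivAt.comp t hσ.hasFDerivAt.hasMFDerivAt).mfderiv
  let L : ℝ →L[ℝ] TangentSpace 𝓘(ℝ, EucSp n) (c (σ t)) :=
    mfderiv 𝓘(ℝ, ℝ) 𝓘(ℝ, EucSp n) c (σ t)
  have h1 : mfderiv 𝓘(ℝ, ℝ) 𝓘(ℝ, EucSp n) (c ∘ σ) t (1 : ℝ) =
      L (ContinuousLinearMap.toSpanSingleton ℝ k 1) :=
    congrArg (fun A : ℝ →L[ℝ] TangentSpace 𝓘(ℝ, EucSp n) (c (σ t)) => A 1) h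
  have h2 : ContinuousLinearMap.toSpanSingleton ℝ k 1 = k • (1 : ℝ) := by simp
  rw [h1, h2]
  exact map_smul L k 1

namespace FibreSeminorm

variable {n : ℕ} {M : Type*} [TopologicalSpace M] [ChartedSpace (EucSp n) M]
  [IsManifold 𝓘(ℝ, EucSp n) ∞ M]

lemma dualNorm_smul_le (P : FibreSeminorm n M) {x : M} {v : TangentSpace 𝓘(ℝ, EucSp n) x}
    {F k : ℝ} (hF : 0 ≤ F) (hv : P.dualNorm x v ≤ ENNReal.ofReal F) (hk : |k| * F ≤ 1) :
    P.dualNorm x (k • v) ≤ 1 := by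
  refine iSup_le fun ξ => ?_
  have h1 : ENNReal.ofReal |ξ.1 v| ≤ ENNReal.ofReal F :=
    (le_iSup (fun ξ : {ξ : CotangentFibre n M x // P.seminorm x ξ ≤ 1} =>
      ENNReal.ofReal |ξ.1 v|) ξ).trans hv
  rw [ENNReal.ofReal_le_ofReal_iff hF] at h1
  rw [map_smul, smul_eq_mul, abs_mul, ← ENNReal.ofReal_one]
  refine ENNReal.ofReal_le_ofReal (le_trans ?_ hk)
  gcongr

lemma dualNorm_zero (P : FibreSeminorm n M) (x : M) : P.dualNorm x 0 = 0 := by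
  simp [dualNorm]

lemma isSubunitCurve_const (P : FibreSeminorm n M) (x : M) (T : ℝ) :
    P.IsSubunitCurve (fun _ => x) 0 T := by
  refine ⟨⟨continuousOn_const, fun φ _ c d _ _ _ _ => ?_⟩, Eventually.of_forall fun t => ?_⟩
  · exact (LipschitzWith.const _).lipschitzOnWith.absolutelyContinuousOnInterval
  · rw [mfderiv_const]
    exact (P.dualNorm_zero x).trans_le zero_le_one

/-- Only positive times compete, so constant curves of arbitrarily short duration are used. -/
lemma controlDist_self (P : FibreSeminorm n M) (x : M) : P.controlDist x x = 0 := by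
  refine le_antisymm (ENNReal.le_of_forall_pos_le_add fun ε hε _ => ?_) zero_le
  rw [zero_add]
  exact (iInf₂_le (ε : ℝ) ⟨hε, fun _ => x, P.isSubunitCurve_const x _, rfl, rfl⟩).trans
    (ENNReal.ofReal_coe_nnreal).le

/-- Subunit curves can be translated and reversed. -/
lemma IsSubunitCurve.comp_affine {P : FibreSeminorm n M} {c : ℝ → M} {T : ℝ}
    (hc : P.IsSubunitCurve c 0 T) {u κ L : ℝ} (hκ : κ = 1 ∨ κ = -1)
    (hmaps : MapsTo (fun t => u + κ * t) (Icc 0 L) (Icc 0 T)) :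
    P.IsSubunitCurve (fun t => c (u + κ * t)) 0 L := by
  refine ⟨⟨hc.1.1.comp (by fun_prop) hmaps, fun φ hφ s t hs hst ht hsource => ?_⟩, ?_⟩
  · refine AbsolutelyContinuousOnInterval.comp_affine (f := fun t => φ (c t)) hκ ?_
    have hs' := hmaps ⟨hs, hst.trans ht⟩
    have ht' := hmaps ⟨hs.trans hst, ht⟩
    rcases hκ with rfl | rfl
    · refine hc.1.2 φ hφ _ _ hs'.1 (by linarith) ht'.2 fun τ hτ => ?_
      have := hsource (x := τ - u) ⟨by linarith [hτ.1], by linarith [hτ.2]⟩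
      simpa using this
    · refine (hc.1.2 φ hφ _ _ ht'.1 (by linarith) hs'.2 fun τ hτ => ?_).symm
      have := hsource (x := u - τ) ⟨by linarith [hτ.2], by linarith [hτ.1]⟩
      simpa using this
  · have h1 := (ae_restrict_iff' measurableSet_Icc).1 hc.2
    have h2 := (measurePreserving_affine hκ u).quasiMeasurePreserving.ae h1
    refine (ae_restrict_iff' measurableSet_Icc).2 ?_
    filter_upwards [h2] with t ht htI
    have h3 := ht (hmaps htI)
    have hσ : HasDerivAt (fun t : ℝ => u + κ * t) κ t := by
      simpa using ((hasDerivAt_id t).const_mul κ).const_add u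
    by_cases hm : MDifferentiableAt 𝓘(ℝ, ℝ) 𝓘(ℝ, EucSp n) c (u + κ * t)
    · have h5 : mfderiv 𝓘(ℝ, ℝ) 𝓘(ℝ, EucSp n) (fun t => c (u + κ * t)) t (1 : ℝ) =
          κ • (mfderiv 𝓘(ℝ, ℝ) 𝓘(ℝ, EucSp n) c (u + κ * t) (1 : ℝ)) :=
        mfderiv_comp_hasDerivAt hm hσ
      rw [h5]
      refine P.dualNorm_smul_le zero_le_one (by rwa [ENNReal.ofReal_one]) ?_
      rcases hκ with rfl | rfl <;> simp
    · have h4 : ¬ MDifferentiableAt 𝓘(ℝ, ℝ) 𝓘(ℝ, EucSp n) (fun t => c (u + κ * t)) t := by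
        intro h
        apply hm
        have hκκ : κ * κ = 1 := by rcases hκ with rfl | rfl <;> norm_num
        have h6 : c = (fun t => c (u + κ * t)) ∘ fun s => κ * (s - u) := by
          funext s
          simp only [Function.comp, ← mul_assoc, hκκ]
          simp
        rw [h6]
        refine MDifferentiableAt.comp (I' := 𝓘(ℝ, ℝ)) _ ?_ ?_
        · have : κ * (u + κ * t - u) = t := by rw [add_sub_cancel_left, ← mul_assoc, hκκ, one_mul]
          rwa [this]
        · exact DifferentiableAt.mdifferentiableAt (by fun_prop)
      rw [mfderiv_zero_of_not_mdifferentiableAt h4]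
      exact (P.dualNorm_zero _).trans_le zero_le_one

lemma IsSubunitCurve.controlDist_le {P : FibreSeminorm n M} {c : ℝ → M} {T : ℝ}
    (hc : P.IsSubunitCurve c 0 T) {u v : ℝ} (hu : u ∈ Icc 0 T) (hv : v ∈ Icc 0 T) :
    P.controlDist (c u) (c v) ≤ ENNReal.ofReal |v - u| := by
  rcases lt_trichotomy u v with h | rfl | h
  · rw [abs_of_pos (sub_pos.2 h)]
    exact iInf₂_le (v - u) ⟨sub_pos.2 h, _, hc.comp_affine (u := u) (κ := 1) (Or.inl rfl)
      (fun t ht => ⟨by linarith [ht.1, hu.1], by linarith [ht.2, hv.2]⟩), by simp, by simp⟩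
  · rw [P.controlDist_self]
    exact zero_le
  · rw [abs_of_neg (sub_neg.2 h), neg_sub]
    exact iInf₂_le (u - v) ⟨sub_pos.2 h, _, hc.comp_affine (u := u) (κ := -1) (Or.inr rfl)
      (fun t ht => ⟨by linarith [ht.2, hv.1], by linarith [ht.1, hu.2]⟩), by simp, by simp⟩

/-- A curve that is a monotone or antitone reparametrisation of a subunit curve on `[0, T]` has
length at most `T`. -/
lemma IsSubunitCurve.curveLength_le {P : FibreSeminorm n M} {c : ℝ → M} {T : ℝ}
    (hc : P.IsSubunitCurve c 0 T) {γ : ℝ → M} {a b : ℝ} {q : ℝ → ℝ}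
    (hq : MonotoneOn q (Icc a b) ∨ AntitoneOn q (Icc a b)) (hmaps : MapsTo q (Icc a b) (Icc 0 T))
    (hγ : ∀ t ∈ Icc a b, γ t = c (q t)) : P.curveLength γ a b ≤ ENNReal.ofReal T := by
  refine iSup_le ?_
  rintro ⟨⟨m, p⟩, hp, hp0, hpm⟩
  simp only at hp hp0 hpm ⊢
  have hpI : ∀ j ≤ m, p j ∈ Icc a b := fun j hj =>
    ⟨hp0 ▸ hp (Nat.zero_le j), hpm ▸ hp hj⟩
  have ha := hmaps (hpI 0 (Nat.zero_le m))
  have hb := hmaps (hpI m le_rfl)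
  calc ∑ j ∈ Finset.range m, P.controlDist (γ (p j)) (γ (p (j + 1)))
      ≤ ∑ j ∈ Finset.range m, ENNReal.ofReal |q (p (j + 1)) - q (p j)| := by
        refine Finset.sum_le_sum fun j hj => ?_
        have hj := Finset.mem_range.1 hj
        rw [hγ _ (hpI j hj.le), hγ _ (hpI (j + 1) hj)]
        exact hc.controlDist_le (hmaps (hpI j hj.le)) (hmaps (hpI (j + 1) hj))
    _ = ENNReal.ofReal (∑ j ∈ Finset.range m, |q (p (j + 1)) - q (p j)|) :=
        (ENNReal.ofReal_sum_of_nonneg fun _ _ => abs_nonneg _).symm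
    _ ≤ ENNReal.ofReal T := by
        refine ENNReal.ofReal_le_ofReal ?_
        rcases hq with hq | hq
        · have : ∀ j ∈ Finset.range m, |q (p (j + 1)) - q (p j)| = q (p (j + 1)) - q (p j) := by
            intro j hj
            have hj := Finset.mem_range.1 hj
            exact abs_of_nonneg (sub_nonneg.2 (hq (hpI j hj.le) (hpI _ hj) (hp j.le_succ)))
          rw [Finset.sum_congr rfl this, Finset.sum_range_sub fun j => q (p j)]
          linarith [hb.2, ha.1]
        · have : ∀ j ∈ Finset.range m, |q (p (j + 1)) - q (p j)| = q (p j) - q (p (j + 1)) := by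
            intro j hj
            have hj := Finset.mem_range.1 hj
            rw [abs_of_nonpos (sub_nonpos.2 (hq (hpI j hj.le) (hpI _ hj) (hp j.le_succ))), neg_sub]
          rw [Finset.sum_congr rfl this, Finset.sum_range_sub' fun j => q (p j)]
          linarith [hb.1, ha.2]

end FibreSeminorm

/-! ### Reparametrisations of the line from a prescribed rate -/

/-- A continuous function on the line that grows at least linearly is a homeomorphism. -/
lemma exists_homeomorph_of_mul_sub_le {S : ℝ → ℝ} (hcont : Continuous S) {ε : ℝ} (hε : 0 < ε)
    (hgrow : ∀ ⦃s t : ℝ⦄, s ≤ t → ε * (t - s) ≤ S t - S s) :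
    ∃ e : ℝ ≃ₜ ℝ, StrictMono e ∧ ∀ t, e t = S t := by
  have hmono : StrictMono S := fun s t hst => by
    have h1 := hgrow hst.le
    have h2 := mul_pos hε (sub_pos.2 hst)
    linarith
  have htop : Tendsto S atTop atTop := by
    refine tendsto_atTop_mono' _ ?_ (tendsto_atTop_add_const_right atTop (S 0)
      (tendsto_id.const_mul_atTop hε))
    filter_upwards [eventually_ge_atTop 0] with t ht
    have := hgrow ht
    simp only [id]
    linarith
  have hbot : Tendsto S atBot atBot := by
    refine tendsto_atBot_mono' _ ?_ (tendsto_atBot_add_const_right atBot (S 0)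
      (tendsto_id.const_mul_atBot hε))
    filter_upwards [eventually_le_atBot 0] with t ht
    have := hgrow ht
    simp only [id]
    linarith
  exact ⟨(hmono.orderIsoOfSurjective S (hcont.surjective htop hbot)).toHomeomorph, hmono,
    fun _ => rfl⟩

/-- The primitive of a continuous function that is bounded below by a positive constant. -/
lemma exists_homeomorph_of_le_deriv {h : ℝ → ℝ} (hh : Continuous h) {ε : ℝ} (hε : 0 < ε)
    (hle : ∀ t, ε ≤ h t) (a : ℝ) :
    ∃ S : ℝ ≃ₜ ℝ, StrictMono S ∧ (∀ t, S t = ∫ s in a..t, h s) ∧ ∀ t, HasDerivAt S (h t) t := by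
  have hd : ∀ t, HasDerivAt (fun t => ∫ s in a..t, h s) (h t) t := fun t =>
    (hh.integral_hasStrictDerivAt a t).hasDerivAt
  obtain ⟨S, hmono, hS⟩ := exists_homeomorph_of_mul_sub_le
    (continuous_iff_continuousAt.2 fun t => (hd t).continuousAt) hε
    (mul_sub_le_image_sub_of_le_deriv (fun t => (hd t).differentiableAt)
      fun t => by rw [(hd t).deriv]; exact hle t)
  exact ⟨S, hmono, hS, fun t => by rw [show ⇑S = _ from funext hS]; exact hd t⟩

/-- A smooth reparametrisation whose rate is slightly smaller than the reciprocal of a given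
continuous function. -/
lemma exists_isSmoothDiffeoOn_deriv_mul_le {F : ℝ → ℝ} {a b : ℝ} (hab : a < b)
    (hF : ContinuousOn F (Icc a b)) (hF0 : ∀ t ∈ Icc a b, 0 ≤ F t) {ε : ℝ} (hε : 0 < ε) :
    ∃ (T : ℝ) (r : ℝ → ℝ), 0 < T ∧ T ≤ (∫ t in a..b, F t) + 2 * ε * (b - a) ∧
      IsSmoothDiffeoOn r (Icc 0 T) (Icc a b) ∧ StrictMono r ∧ r 0 = a ∧ r T = b ∧
      ContDiff ℝ ∞ r ∧ ∀ t ∈ Icc 0 T, |deriv r t| * F (r t) ≤ 1 := by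
  set G : ℝ → ℝ := IccExtend hab.le (domRestrict (Icc a b) F) with hG
  have hGc : Continuous G := (continuousOn_iff_continuous_domRestrict.1 hF).Icc_extend'
  have hGF : ∀ t ∈ Icc a b, G t = F t := fun t ht => IccExtend_of_mem hab.le _ ht
  have hG0 : ∀ t, 0 ≤ G t := fun t => hF0 _ (projIcc a b hab.le t).2
  -- A partition of unity gives a smooth `h` strictly between `G + ε` and `G + 2ε`. Its primitive
  -- `S` has slope at least `ε`, so the inverse is smooth even where `F` vanishes.
  obtain ⟨h, hh⟩ := exists_contMDiffMap_forall_mem_convex_of_local_const (n := ⊤) 𝓘(ℝ, ℝ)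
    (t := fun t => Ioo (G t + ε) (G t + 2 * ε)) (fun t => convex_Ioo _ _) fun t => by
      refine ⟨G t + 3 / 2 * ε, ?_⟩
      have h1 : ∀ᶠ s in 𝓝 t, G s + ε < G t + 3 / 2 * ε :=
        ((hGc.add continuous_const).tendsto t).eventually_lt_const (by simp only [Pi.add_apply]; linarith)
      have h2 : ∀ᶠ s in 𝓝 t, G t + 3 / 2 * ε < G s + 2 * ε :=
        ((hGc.add continuous_const).tendsto t).eventually_const_lt (by simp only [Pi.add_apply]; linarith)
      filter_upwards [h1, h2] with s hs1 hs2 using ⟨hs1, hs2⟩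
  have hhs : ContDiff ℝ ∞ h := h.contMDiff.contDiff
  have hle : ∀ t, ε ≤ h t := fun t => by linarith [(hh t).1, hG0 t]
  obtain ⟨S, hmono, hSint, hd⟩ := exists_homeomorph_of_le_deriv hhs.continuous hε hle a
  have hSs : ContDiff ℝ ∞ S := by
    rw [contDiff_infty_iff_deriv]
    refine ⟨fun t => (hd t).differentiableAt, ?_⟩
    rwa [show deriv S = h from funext fun t => (hd t).deriv]
  have hrs : ContDiff ℝ ∞ S.symm :=
    S.contDiff_symm_deriv (fun t => (hε.trans_le (hle t)).ne') hd hSs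
  have hSa : S a = 0 := by rw [hSint, intervalIntegral.integral_same]
  have hrmono : StrictMono S.symm := fun s t hst => by
    rw [← hmono.lt_iff_lt]
    simpa using hst
  have hr0 : S.symm 0 = a := by rw [← hSa, S.symm_apply_apply]
  have hrT : S.symm (S b) = b := S.symm_apply_apply b
  have hmapsr : MapsTo S.symm (Icc 0 (S b)) (Icc a b) := fun t ht =>
    ⟨hr0 ▸ hrmono.monotone ht.1, hrT ▸ hrmono.monotone ht.2⟩
  refine ⟨S b, S.symm, hSa ▸ hmono hab, ?_, ⟨hrs.contDiffOn, hmapsr, S, hSs.contDiffOn,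
    fun t ht => ⟨hSa ▸ hmono.monotone ht.1, hmono.monotone ht.2⟩,
    fun t _ => S.apply_symm_apply t, fun t _ => S.symm_apply_apply t⟩, hrmono, hr0, hrT, hrs, ?_⟩
  · have hint : IntervalIntegrable F volume a b :=
      (hF.mono (uIcc_of_le hab.le).subset).intervalIntegrable
    have h1 : (∫ t in a..b, F t) + 2 * ε * (b - a) = ∫ t in a..b, (F t + 2 * ε) := by
      rw [intervalIntegral.integral_add hint (by simp), intervalIntegral.integral_const,
        smul_eq_mul, mul_comm (b - a)]
    rw [h1, hSint]
    refine intervalIntegral.integral_mono_on hab.le (hhs.continuous.intervalIntegrable _ _)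
      (hint.add (by simp)) fun t ht => ?_
    rw [← hGF t ht]
    exact (hh t).2.le
  · intro t ht
    have hpos : 0 < h (S.symm t) := hε.trans_le (hle _)
    have hder : HasDerivAt S.symm (h (S.symm t))⁻¹ t :=
      (hd (S.symm t)).of_local_left_inverse S.symm.continuous.continuousAt hpos.ne'
        (Eventually.of_forall S.apply_symm_apply)
    rw [hder.deriv, abs_of_pos (inv_pos.2 hpos), inv_mul_le_iff₀ hpos, mul_one,
      ← hGF _ (hmapsr ht)]
    linarith [(hh (S.symm t)).1]

/-! ### The length formula -/

namespace FibreSeminorm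

variable {n : ℕ} {M : Type*} [TopologicalSpace M] [ChartedSpace (EucSp n) M]
  [IsManifold 𝓘(ℝ, EucSp n) ∞ M]

lemma isACCurve_of_contMDiffOn {γ : ℝ → M} {a b : ℝ}
    (hγ : ContMDiffOn 𝓘(ℝ, ℝ) 𝓘(ℝ, EucSp n) 1 γ (Icc a b)) : IsACCurve n γ a b := by
  refine ⟨hγ.continuousOn, fun φ hφ c d hac hcd hdb hmaps => ?_⟩
  refine ContDiffOn.absolutelyContinuousOnInterval ?_
  rw [uIcc_of_le hcd, ← contMDiffOn_iff_contDiffOn]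
  exact (contMDiffOn_of_mem_maximalAtlas (IsManifold.subset_maximalAtlas hφ)).comp
    (hγ.mono (Icc_subset_Icc hac hdb)) hmaps

variable (P : FibreSeminorm n M) {γ : ℝ → M} {a b : ℝ}

/-- The inverse diffeomorphism is continuous and injective on an interval, hence strictly monotone
or strictly antitone; both orientations occur. -/
lemma curveLength_le_of_mem_smoothReparamTimes (hab : a < b) {T : ℝ}
    (hT : T ∈ P.smoothReparamTimes γ a b) : P.curveLength γ a b ≤ ENNReal.ofReal T := by
  obtain ⟨-, r, ⟨-, -, q, hq, hmaps, hinv⟩, hsub⟩ := hT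
  have hinj : InjOn q (Icc a b) := hinv.2.injOn
  refine hsub.curveLength_le (q := q) ?_ hmaps fun t ht => (congrArg γ (hinv.2 ht)).symm
  exact (hq.continuousOn.strictMonoOn_of_injOn_Icc' hab.le hinj).imp
    StrictMonoOn.monotoneOn StrictAntiOn.antitoneOn

lemma isSubunitCurve_comp_of_deriv_mul_le
    (hγ : ContMDiffOn 𝓘(ℝ, ℝ) 𝓘(ℝ, EucSp n) 1 γ (Icc a b)) {F : ℝ → ℝ}
    (hF0 : ∀ t ∈ Icc a b, 0 ≤ F t)
    (hF : ∀ t ∈ Icc a b, P.speed γ a b t ≤ ENNReal.ofReal (F t)) {r : ℝ → ℝ} {T : ℝ}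
    (hr : ContDiff ℝ ∞ r) (hmono : StrictMono r) (hr0 : r 0 = a) (hrT : r T = b)
    (hle : ∀ t ∈ Icc 0 T, |deriv r t| * F (r t) ≤ 1) : P.IsSubunitCurve (γ ∘ r) 0 T := by
  have hmaps : MapsTo r (Icc 0 T) (Icc a b) := fun t ht =>
    ⟨hr0 ▸ hmono.monotone ht.1, hrT ▸ hmono.monotone ht.2⟩
  refine ⟨isACCurve_of_contMDiffOn (hγ.comp (hr.of_le (by simp)).contMDiff.contMDiffOn hmaps),
    (ae_restrict_iff' measurableSet_Icc).2 ?_⟩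
  -- The end points are discarded: `γ` is controlled only on `[a, b]`, so the two-sided derivative
  -- is known only inside.
  have h0 : ∀ᵐ t : ℝ, t ≠ 0 := by simp [ae_iff, measure_singleton]
  have hT : ∀ᵐ t : ℝ, t ≠ T := by simp [ae_iff, measure_singleton]
  filter_upwards [h0, hT] with t ht0 htT ht
  have hnhds : Icc a b ∈ 𝓝 (r t) := Icc_mem_nhds
    (hr0 ▸ hmono (lt_of_le_of_ne ht.1 ht0.symm)) (hrT ▸ hmono (lt_of_le_of_ne ht.2 htT))
  have hm : MDifferentiableAt 𝓘(ℝ, ℝ) 𝓘(ℝ, EucSp n) γ (r t) :=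
    (hγ.contMDiffAt hnhds).mdifferentiableAt one_ne_zero
  have hd : HasDerivAt r (deriv r t) t := (hr.differentiable (by simp) t).hasDerivAt
  rw [mfderiv_comp_hasDerivAt hm hd]
  refine P.dualNorm_smul_le (hF0 _ (hmaps ht)) ?_ (hle t ht)
  have := hF _ (hmaps ht)
  rwa [speed, mfderivWithin_of_mem_nhds hnhds] at this

/-- The length of a `C¹` curve is the infimum of the times of its smooth subunit
reparametrisations, if the null spaces have locally constant dimension. -/
theorem curveLength_eq_iInf_smoothReparamTimes [T2Space M]
    (hdim : Continuous (fun x : M => Module.finrank ℝ (P.zeroSubspace x))) (hab : a < b)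
    (hγ : ContMDiffOn 𝓘(ℝ, ℝ) 𝓘(ℝ, EucSp n) 1 γ (Icc a b)) :
    P.curveLength γ a b = ⨅ T ∈ P.smoothReparamTimes γ a b, ENNReal.ofReal T := by
  refine le_antisymm
    (le_iInf₂ fun T hT => P.curveLength_le_of_mem_smoothReparamTimes hab hT) ?_
  by_cases hL : P.curveLength γ a b = ⊤
  · rw [hL]
    exact le_top
  refine ENNReal.le_of_forall_pos_le_add fun δ hδ _ => ?_
  have hba : 0 < b - a := sub_pos.2 hab
  have hδ' : (0 : ℝ) < δ := hδ
  -- The error `δ` is three times `ε (b - a)`: one share for the strict lower bound `F - ε`, two for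
  -- the reparametrisation time.
  set ε : ℝ := δ / (3 * (b - a)) with hε
  have hεpos : 0 < ε := by positivity
  set F : ℝ → ℝ := fun t => (P.speed γ a b t).toReal with hF
  have hfin : ∀ t ∈ Icc a b, P.speed γ a b t = ENNReal.ofReal (F t) := fun t ht =>
    (ENNReal.ofReal_toReal (P.speed_ne_top_of_curveLength_ne_top hdim hab hγ hL ht)).symm
  have hFc : ContinuousOn F (Icc a b) := P.continuousOn_toReal_speed hdim hab hγ hL
  have hF0 : ∀ t ∈ Icc a b, 0 ≤ F t := fun t _ => ENNReal.toReal_nonneg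
  have hlow := P.ofReal_integral_le_curveLength hab hγ (g := fun t => F t - ε)
    (hFc.sub continuousOn_const) fun t ht => by
      refine or_iff_not_imp_left.2 fun h => ?_
      rw [hfin t ht, ENNReal.ofReal_lt_ofReal_iff']
      constructor <;> linarith
  have hint : IntervalIntegrable F volume a b :=
    (hFc.mono (uIcc_of_le hab.le).subset).intervalIntegrable
  rw [ENNReal.ofReal_le_iff_le_toReal hL, intervalIntegral.integral_sub hint (by simp),
    intervalIntegral.integral_const, smul_eq_mul] at hlow
  obtain ⟨T, r, hT0, hT, hdiff, hmono, hr0, hrT, hr, hle⟩ :=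
    exists_isSmoothDiffeoOn_deriv_mul_le hab hFc hF0 hεpos
  have hmem : T ∈ P.smoothReparamTimes γ a b := ⟨hT0, r, hdiff,
    P.isSubunitCurve_comp_of_deriv_mul_le hγ hF0 (fun t ht => (hfin t ht).le) hr hmono hr0
      hrT hle⟩
  calc ⨅ T ∈ P.smoothReparamTimes γ a b, ENNReal.ofReal T ≤ ENNReal.ofReal T := iInf₂_le T hmem
    _ ≤ ENNReal.ofReal ((P.curveLength γ a b).toReal + δ) := by
        refine ENNReal.ofReal_le_ofReal ?_
        have : 3 * ((b - a) * ε) = δ := by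
          rw [hε]
          field_simp
        linarith
    _ = P.curveLength γ a b + δ := by
        rw [ENNReal.ofReal_add ENNReal.toReal_nonneg hδ'.le, ENNReal.ofReal_toReal hL,
          ENNReal.ofReal_coe_nnreal]

end FibreSeminorm

/-! ### The counterexample in the plane -/

/-- The linear map `ξ ↦ (ξ₁ / 2, ξ₁ + k ξ₂)` on the covectors of the plane. -/
noncomputable def shearMap (k : ℝ) : (EucSp 2 →L[ℝ] ℝ) →ₗ[ℝ] ℝ × ℝ where
  toFun ξ := (2⁻¹ * ξ (EuclideanSpace.single 0 1),
    ξ (EuclideanSpace.single 0 1) + k * ξ (EuclideanSpace.single 1 1))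
  map_add' ξ η := by
    ext <;> simp only [add_apply, Prod.fst_add, Prod.snd_add] <;> ring
  map_smul' c ξ := by
    ext <;> simp only [smul_apply, smul_eq_mul, RingHom.id_apply, Prod.smul_fst,
      Prod.smul_snd] <;> ring

lemma trivializationAt_cotangent_apply (x : EucSp 2) (ξ : CotangentFibre 2 (EucSp 2) x) :
    (trivializationAt (EucSp 2 →L[ℝ] ℝ) (CotangentFibre 2 (EucSp 2)) 0 ⟨x, ξ⟩).2 = ξ := by
  rw [hom_trivializationAt_apply]
  simp [ContinuousLinearMap.inCoordinates]
  rfl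

/-- The fibre seminorm `max (|ξ₁| / 2, |ξ₁ + a(x₁) ξ₂|)` of the plane. -/
noncomputable def shearSeminorm (a : ℝ → ℝ) (ha : Continuous a) : FibreSeminorm 2 (EucSp 2) where
  seminorm x := ((normSeminorm ℝ (ℝ × ℝ)).comp (shearMap (a (x 0))) :)
  continuous_seminorm := by
    let e := trivializationAt (EucSp 2 →L[ℝ] ℝ) (CotangentFibre 2 (EucSp 2)) 0
    have hsource : e.source = univ := by
      ext; simp [e, chartAt_self_eq]
    have h1 : Continuous e := by
      rw [← continuousOn_univ, ← hsource]
      exact e.continuousOn_toFun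
    have h2 : Continuous fun z : EucSp 2 × (EucSp 2 →L[ℝ] ℝ) =>
        ‖(2⁻¹ * z.2 (EuclideanSpace.single 0 1), z.2 (EuclideanSpace.single 0 1) +
          a (z.1 0) * z.2 (EuclideanSpace.single 1 1))‖ := by
      fun_prop
    refine (h2.comp h1).congr ?_
    rintro ⟨x, ξ⟩
    have h3 : e ⟨x, ξ⟩ = (x, ξ) := Prod.ext rfl (trivializationAt_cotangent_apply x ξ)
    simp only [Function.comp, h3]
    rfl

/-- The horizontal line. -/
noncomputable def horizontalLine (t : ℝ) : EucSp 2 := t • EuclideanSpace.single 0 1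

lemma shearSeminorm_apply {a : ℝ → ℝ} (ha : Continuous a) (x : EucSp 2) (ξ : EucSp 2 →L[ℝ] ℝ) :
    (shearSeminorm a ha).seminorm x ξ = max |2⁻¹ * ξ (EuclideanSpace.single 0 1)|
      |ξ (EuclideanSpace.single 0 1) + a (x 0) * ξ (EuclideanSpace.single 1 1)| := rfl

lemma horizontalLine_apply_zero (t : ℝ) : horizontalLine t 0 = t := by
  simp [horizontalLine]

lemma contDiff_horizontalLine : ContDiff ℝ ∞ horizontalLine :=
  contDiff_id.smul contDiff_const

lemma mfderiv_horizontalLine_comp {r : ℝ → ℝ} {t k : ℝ} (hr : HasDerivAt r k t) :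
    mfderiv 𝓘(ℝ, ℝ) 𝓘(ℝ, EucSp 2) (horizontalLine ∘ r) t (1 : ℝ) =
      (k • EuclideanSpace.single 0 1 : EucSp 2) := by
  have h : HasDerivAt (horizontalLine ∘ r) (k • EuclideanSpace.single 0 1 : EucSp 2) t :=
    hr.smul_const _
  rw [mfderiv_eq_fderiv]
  exact h.deriv

/-- Admissibility always forces `|ξ₁| ≤ 2`, and `|ξ₁| ≤ 1` at the zeros of `a`. -/
lemma dualNorm_shearSeminorm_le {a : ℝ → ℝ} (ha : Continuous a) {x : EucSp 2} {k : ℝ}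
    (h : |k| ≤ 1 / 2 ∨ |k| ≤ 1 ∧ a (x 0) = 0) :
    (shearSeminorm a ha).dualNorm x (k • EuclideanSpace.single 0 1 : EucSp 2) ≤ 1 := by
  refine iSup_le ?_
  rintro ⟨ξ, hξ⟩
  change EucSp 2 →L[ℝ] ℝ at ξ
  rw [shearSeminorm_apply, max_le_iff] at hξ
  change ENNReal.ofReal |ξ (k • EuclideanSpace.single 0 1)| ≤ 1
  rw [map_smul, smul_eq_mul, ← ENNReal.ofReal_one, abs_mul]
  refine ENNReal.ofReal_le_ofReal ?_
  rcases h with h | ⟨h, h0⟩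
  · have h1 := hξ.1
    rw [abs_mul, abs_of_pos (by norm_num : (0 : ℝ) < 2⁻¹)] at h1
    nlinarith [abs_nonneg (ξ (EuclideanSpace.single 0 1)), abs_nonneg k]
  · have h1 := hξ.2
    rw [h0, zero_mul, add_zero] at h1
    nlinarith [abs_nonneg (ξ (EuclideanSpace.single 0 1)), abs_nonneg k]

/-- Where `a ≠ 0` the covector `(2, -2/a)` is admissible, its second component being chosen to
cancel `ξ₁ + a ξ₂`. -/
lemma abs_le_half_of_dualNorm_shearSeminorm_le {a : ℝ → ℝ} (ha : Continuous a) {x : EucSp 2}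
    {k : ℝ} (hx : a (x 0) ≠ 0)
    (h : (shearSeminorm a ha).dualNorm x (k • EuclideanSpace.single 0 1 : EucSp 2) ≤ 1) :
    |k| ≤ 1 / 2 := by
  let ξ : EucSp 2 →L[ℝ] ℝ := (2 : ℝ) • EuclideanSpace.proj 0 -
    (2 / a (x 0)) • EuclideanSpace.proj 1
  have h0 : ξ (EuclideanSpace.single 0 1) = 2 := by simp [ξ]
  have h1 : ξ (EuclideanSpace.single 1 1) = -(2 / a (x 0)) := by simp [ξ]
  have hξ : (shearSeminorm a ha).seminorm x ξ ≤ 1 := by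
    rw [shearSeminorm_apply, h0, h1]
    refine max_le (by norm_num) ?_
    rw [mul_neg, mul_div_cancel₀ _ hx]
    norm_num
  have h2 : ENNReal.ofReal |ξ (k • EuclideanSpace.single 0 1)| ≤ 1 :=
    (le_iSup (fun ξ : {ξ : CotangentFibre 2 (EucSp 2) x // (shearSeminorm a ha).seminorm x ξ ≤ 1} =>
      ENNReal.ofReal |ξ.1 (k • EuclideanSpace.single 0 1 : EucSp 2)|) ⟨ξ, hξ⟩).trans h
  rw [map_smul, h0, smul_eq_mul, abs_mul, ENNReal.ofReal_le_one,
    abs_of_pos (two_pos : (0 : ℝ) < 2)] at h2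
  linarith

/-- If `a` is nonzero on a dense set, then `C¹` subunit reparametrisations of the horizontal unit
segment need at least time `2`. -/
lemma two_le_of_isSubunitCurve_horizontalLine {a : ℝ → ℝ} (ha : Continuous a)
    (hdense : Dense {x | a x ≠ 0}) {T : ℝ} {r : ℝ → ℝ} (hr : ContDiffOn ℝ 1 r (Icc 0 T))
    (himage : r '' Icc 0 T = Icc 0 1)
    (hsub : (shearSeminorm a ha).IsSubunitCurve (horizontalLine ∘ r) 0 T) : 2 ≤ T := by
  have hr' : ContDiffOn ℝ 1 r (Ioo 0 T) := hr.mono Ioo_subset_Icc_self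
  have hdiff : ∀ t ∈ Ioo 0 T, HasStrictDerivAt r (deriv r t) t := fun t ht =>
    (hr'.contDiffAt (isOpen_Ioo.mem_nhds ht)).hasStrictDerivAt one_ne_zero
  have hderiv : ContinuousOn (deriv r) (Ioo 0 T) :=
    hr'.continuousOn_deriv_of_isOpen isOpen_Ioo le_rfl
  have hbound : ∀ t ∈ Ioo 0 T, |deriv r t| ≤ 1 / 2 := by
    by_contra! hcon
    obtain ⟨t₀, ht₀, hgt⟩ := hcon
    set W := Ioo 0 T ∩ (fun t => |deriv r t|) ⁻¹' Ioi (1 / 2) with hW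
    have hWopen : IsOpen W := hderiv.abs.isOpen_inter_preimage isOpen_Ioo isOpen_Ioi
    have hne : deriv r t₀ ≠ 0 := by
      intro h
      rw [h, abs_zero] at hgt
      linarith
    -- With nonzero derivative `r` is open at `t₀`, so the image of the fast set `W` meets the dense
    -- set where `a ≠ 0`.
    have himg : r '' W ∈ 𝓝 (r t₀) := by
      rw [← (hdiff t₀ ht₀).map_nhds_eq hne]
      exact image_mem_map (hWopen.mem_nhds ⟨ht₀, hgt⟩)
    obtain ⟨_, hx, t₁, ht₁, rfl⟩ := mem_closure_iff_nhds.1 (hdense (r t₀)) _ himg |>.imp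
      fun x hx => And.intro hx.2 hx.1
    set W' := W ∩ (a ∘ r) ⁻¹' {0}ᶜ with hW'
    have hW'open : IsOpen W' :=
      (ha.comp_continuousOn (hr.continuousOn.mono
        (inter_subset_left.trans Ioo_subset_Icc_self))).isOpen_inter_preimage hWopen
        isOpen_compl_singleton
    -- The subunit condition holds only almost everywhere, but a set of full measure meets the
    -- nonempty open set `W'`.
    obtain ⟨t, htW', ht⟩ := (Measure.dense_of_ae
      ((ae_restrict_iff' measurableSet_Icc).1 hsub.2)).inter_open_nonempty W' hW'open
      ⟨t₁, ht₁, hx⟩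
    have h1 := ht (Ioo_subset_Icc_self htW'.1.1)
    rw [mfderiv_horizontalLine_comp (hdiff t htW'.1.1).hasDerivAt] at h1
    have h2 := abs_le_half_of_dualNorm_shearSeminorm_le ha
      (by rw [Function.comp, horizontalLine_apply_zero]; exact htW'.2) h1
    exact absurd htW'.1.2 (not_lt.2 h2)
  obtain ⟨s, hs, hs0⟩ : (0 : ℝ) ∈ r '' Icc 0 T := himage ▸ ⟨le_rfl, zero_le_one⟩
  obtain ⟨s', hs', hs1⟩ : (1 : ℝ) ∈ r '' Icc 0 T := himage ▸ ⟨zero_le_one, le_rfl⟩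
  have hdo : DifferentiableOn ℝ r (interior (Icc 0 T)) := by
    rw [interior_Icc]
    exact fun t ht => (hdiff t ht).hasDerivAt.differentiableAt.differentiableWithinAt
  rcases le_total s s' with hss | hss
  · have h := (convex_Icc 0 T).image_sub_le_mul_sub_of_deriv_le hr.continuousOn hdo (C := 1 / 2)
      (fun t ht => (abs_le.1 (hbound t (by rwa [interior_Icc] at ht))).2) s hs s' hs' hss
    rw [hs0, hs1] at h
    linarith [hs.1, hs'.2]
  · have h := (convex_Icc 0 T).mul_sub_le_image_sub_of_le_deriv hr.continuousOn hdo
      (C := -(1 / 2))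
      (fun t ht => (abs_le.1 (hbound t (by rwa [interior_Icc] at ht))).1) s' hs' s hs hss
    rw [hs0, hs1] at h
    linarith [hs'.1, hs.2]

/-- A homeomorphism of the line that has slope `1 / 2` on a dense open set of small measure and
slope `1` almost everywhere else. -/
lemma exists_homeomorph_slope_half : ∃ (U : Set ℝ) (ρ : ℝ ≃ₜ ℝ) (T : ℝ), IsOpen U ∧ Dense U ∧
    Uᶜ.Nonempty ∧ StrictMono ρ ∧ LipschitzWith 1 ρ ∧ ρ 0 = 0 ∧ ρ T = 1 ∧ 0 < T ∧ T ≤ 3 / 2 ∧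
    ∀ᵐ t, HasDerivAt ρ (1 - U.indicator (fun _ => 1 / 2) t) t := by
  -- The rationals are null, so they have an open neighbourhood of measure below 1. Slope 1/2 on it
  -- costs at most 1/2 in height, which gives `T ≤ 1 + 1/2`.
  obtain ⟨U, hQU, hU, hvol⟩ := (range ((↑) : ℚ → ℝ)).exists_isOpen_lt_of_lt (μ := volume) 1
    (by rw [(countable_range _).measure_zero]; exact one_pos)
  have hdense : Dense U := Rat.denseRange_cast.mono hQU
  set χ : ℝ → ℝ := U.indicator fun _ => 1 / 2 with hχ
  have hχint : Integrable χ := (integrable_indicator_iff hU.measurableSet).2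
    (integrableOn_const (hvol.trans ENNReal.one_lt_top).ne)
  have hχ0 : ∀ t, 0 ≤ χ t := fun t => indicator_nonneg (fun _ _ => by norm_num) t
  have hχ1 : ∀ t, χ t ≤ 1 / 2 := fun t => indicator_le_self' (fun _ _ => by norm_num) t
  have hχtotal : ∫ t, χ t ≤ 1 / 2 := by
    rw [hχ, integral_indicator hU.measurableSet, setIntegral_const, smul_eq_mul]
    have : volume.real U ≤ 1 := ENNReal.toReal_le_of_le_ofReal zero_le_one (by simpa using hvol.le)
    linarith
  have hint : ∀ s t, IntervalIntegrable (fun t => 1 - χ t) volume s t := fun s t =>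
    (intervalIntegrable_const).sub hχint.intervalIntegrable
  set S : ℝ → ℝ := fun t => ∫ s in (0 : ℝ)..t, (1 - χ s) with hS
  have hdiff : ∀ s t, S t - S s = ∫ τ in s..t, (1 - χ τ) := fun s t =>
    intervalIntegral.integral_interval_sub_left (hint _ _) (hint _ _)
  have hlow : ∀ ⦃s t : ℝ⦄, s ≤ t → 1 / 2 * (t - s) ≤ S t - S s := by
    intro s t hst
    rw [hdiff]
    have := intervalIntegral.integral_mono_on hst (intervalIntegrable_const (c := (1 / 2 : ℝ)))
      (hint s t) fun τ _ => by linarith [hχ1 τ]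
    rw [intervalIntegral.integral_const, smul_eq_mul] at this
    linarith
  have hup : ∀ ⦃s t : ℝ⦄, s ≤ t → S t - S s ≤ t - s := by
    intro s t hst
    rw [hdiff]
    have := intervalIntegral.integral_mono_on hst (hint s t)
      (intervalIntegrable_const (c := (1 : ℝ))) fun τ _ => by linarith [hχ0 τ]
    rwa [intervalIntegral.integral_const, smul_eq_mul, mul_one] at this
  have hlip : LipschitzWith 1 S := by
    refine LipschitzWith.of_dist_le_mul fun s t => ?_
    rw [NNReal.coe_one, one_mul, Real.dist_eq, Real.dist_eq]
    rcases le_total s t with h | h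
    · rw [abs_sub_comm, abs_sub_comm s]
      rw [abs_of_nonneg (by linarith [hlow h]), abs_of_nonneg (by linarith)]
      exact hup h
    · rw [abs_of_nonneg (by linarith [hlow h]), abs_of_nonneg (by linarith)]
      exact hup h
  obtain ⟨ρ, hmono, hρ⟩ := exists_homeomorph_of_mul_sub_le hlip.continuous one_half_pos hlow
  have hρS : ⇑ρ = S := funext hρ
  have hρ0 : ρ 0 = 0 := by rw [hρ]; exact intervalIntegral.integral_same
  have hT : ρ (ρ.symm 1) = 1 := ρ.apply_symm_apply 1
  have hT0 : 0 < ρ.symm 1 := by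
    rw [← hmono.lt_iff_lt, hρ0, hT]
    exact one_pos
  refine ⟨U, ρ, ρ.symm 1, hU, hdense, ?_, hmono, hρS ▸ hlip, hρ0, hT, hT0, ?_, ?_⟩
  -- A nonempty complement is needed because `Metric.infDist` to the empty set is 0 by default.
  · by_contra h
    rw [not_nonempty_iff_eq_empty, compl_empty_iff] at h
    rw [h, Real.volume_univ] at hvol
    exact not_top_lt hvol
  · have h1 : ∫ s in (0 : ℝ)..(ρ.symm 1), χ s ≤ ∫ s, χ s := by
      rw [intervalIntegral.integral_of_le hT0.le]
      exact setIntegral_le_integral hχint (Eventually.of_forall hχ0)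
    have h2 := hT
    rw [hρ, hS] at h2
    simp only at h2
    rw [intervalIntegral.integral_sub intervalIntegrable_const hχint.intervalIntegrable,
      intervalIntegral.integral_const, smul_eq_mul, mul_one, sub_zero] at h2
    linarith
  · have hloc : LocallyIntegrable (fun t => 1 - χ t) volume :=
      (locallyIntegrable_const 1).sub hχint.locallyIntegrable
    filter_upwards [LocallyIntegrable.ae_hasDerivAt_integral hloc] with t ht
    rw [hρS]
    exact ht 0

/-- The length formula fails for some fibre seminorm on the plane whose null spaces do not have
locally constant dimension. -/
theorem exists_curveLength_ne_iInf_smoothReparamTimes :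
    ∃ (P : FibreSeminorm 2 (EucSp 2)) (γ : ℝ → EucSp 2), ContDiff ℝ ∞ γ ∧
      P.curveLength γ 0 1 ≠ (⨅ T ∈ P.smoothReparamTimes γ 0 1, ENNReal.ofReal T) ∧
      P.curveLength γ 0 1 ≤ 3 / 2 ∧
      ∀ (T : ℝ) (r : ℝ → ℝ), 0 < T → ContDiffOn ℝ 1 r (Icc 0 T) →
        r '' Icc 0 T = Icc 0 1 → P.IsSubunitCurve (γ ∘ r) 0 T → 2 ≤ T := by
  obtain ⟨U, ρ, T₁, hU, hdense, hne, hmono, hlip, hρ0, hρT, hT0, hT, hder⟩ :=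
    exists_homeomorph_slope_half
  -- This choice of `a` vanishes exactly off `ρ(U)`, so `ρ` has slope 1/2 precisely while the line
  -- passes through `a ≠ 0`, up to a null set of times.
  have ha : Continuous fun x => Metric.infDist (ρ.symm x) Uᶜ :=
    (Metric.continuous_infDist_pt _).comp ρ.symm.continuous
  have hmem : ∀ t, Metric.infDist t Uᶜ = 0 ↔ t ∉ U := fun t =>
    (hU.isClosed_compl.mem_iff_infDist_zero hne).symm
  have hdense' : Dense {x | Metric.infDist (ρ.symm x) Uᶜ ≠ 0} := by
    have : {x | Metric.infDist (ρ.symm x) Uᶜ ≠ 0} = ρ.symm ⁻¹' U := by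
      ext x
      simp only [mem_ofPred_eq, ne_eq, hmem, not_not, mem_preimage]
    rw [this]
    exact hdense.preimage ρ.symm.isOpenMap
  set P := shearSeminorm _ ha with hP
  have hlower : ∀ (T : ℝ) (r : ℝ → ℝ), ContDiffOn ℝ 1 r (Icc 0 T) →
      r '' Icc 0 T = Icc 0 1 → P.IsSubunitCurve (horizontalLine ∘ r) 0 T → 2 ≤ T :=
    fun T r hr himage hsub => two_le_of_isSubunitCurve_horizontalLine ha hdense' hr himage hsub
  have hsub : P.IsSubunitCurve (horizontalLine ∘ ρ) 0 T₁ := by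
    have hlip' : ∃ K, LipschitzWith K (horizontalLine ∘ ρ) :=
      ⟨_, ((ContinuousLinearMap.toSpanSingleton ℝ
        (EuclideanSpace.single 0 1 : EucSp 2)).lipschitz).comp hlip⟩
    obtain ⟨K, hK⟩ := hlip'
    refine ⟨⟨hK.continuous.continuousOn, fun φ hφ c d _ _ _ _ => ?_⟩, ae_restrict_of_ae ?_⟩
    · rw [chartedSpaceSelf_atlas] at hφ
      subst hφ
      exact hK.lipschitzOnWith.absolutelyContinuousOnInterval
    · filter_upwards [hder] with t ht
      rw [mfderiv_horizontalLine_comp ht]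
      refine dualNorm_shearSeminorm_le ha ?_
      rw [Function.comp, horizontalLine_apply_zero, ρ.symm_apply_apply, hmem]
      by_cases htU : t ∈ U
      · left
        rw [indicator_of_mem htU]
        norm_num
      · right
        rw [indicator_of_notMem htU]
        exact ⟨by norm_num, htU⟩
  have hupper : P.curveLength horizontalLine 0 1 ≤ 3 / 2 := by
    have hsymm : StrictMono ρ.symm := fun s t hst => by
      rw [← hmono.lt_iff_lt]
      simpa using hst
    have h0 : ρ.symm 0 = 0 := by rw [← hρ0, ρ.symm_apply_apply, hρ0]
    have h1 : ρ.symm 1 = T₁ := by rw [← hρT, ρ.symm_apply_apply]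
    have h2 := hsub.curveLength_le (γ := horizontalLine) (a := 0) (b := 1) (q := ρ.symm)
      (Or.inl (hsymm.monotone.monotoneOn _))
      (fun t ht => ⟨h0 ▸ hsymm.monotone ht.1, h1 ▸ hsymm.monotone ht.2⟩)
      fun t _ => (congrArg horizontalLine (ρ.apply_symm_apply t)).symm
    refine h2.trans ((ENNReal.ofReal_le_ofReal hT).trans (le_of_eq ?_))
    rw [ENNReal.ofReal_div_of_pos two_pos]
    simp
  refine ⟨P, horizontalLine, contDiff_horizontalLine, ?_, hupper, fun T r _ => hlower T r⟩
  have h2 : (2 : ℝ≥0∞) ≤ ⨅ T ∈ P.smoothReparamTimes horizontalLine 0 1, ENNReal.ofReal T := by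
    refine le_iInf₂ ?_
    rintro T ⟨-, r, ⟨hr, hmaps, q, -, hmapsq, hinv⟩, hsub⟩
    have := hlower T r (hr.of_le (by simp)) (hinv.bijOn hmaps hmapsq).image_eq hsub
    rw [← ENNReal.ofReal_ofNat]
    exact ENNReal.ofReal_le_ofReal this
  refine (lt_of_le_of_lt hupper (lt_of_lt_of_le ?_ h2)).ne
  rw [ENNReal.div_lt_iff (by simp) (by simp)]
  norm_num

theorem mainTheorem12 :
    -- the length formula when `x ↦ dim Z(Pₓ)` is continuous
    (∀ (n : ℕ) (M : Type*) [TopologicalSpace M] [T2Space M] [SigmaCompactSpace M]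
      [ChartedSpace (EucSp n) M] [IsManifold 𝓘(ℝ, EucSp n) ∞ M]
      (P : FibreSeminorm n M),
      Continuous (fun x : M => Module.finrank ℝ (P.zeroSubspace x)) →
      ∀ (a b : ℝ), a < b → ∀ γ : ℝ → M,
        ContMDiffOn 𝓘(ℝ, ℝ) 𝓘(ℝ, EucSp n) 1 γ (Icc a b) →
        P.curveLength γ a b = ⨅ T ∈ P.smoothReparamTimes γ a b, ENNReal.ofReal T) ∧
    -- it fails without the continuity hypothesis
    (∃ (P : FibreSeminorm 2 (EucSp 2)) (γ : ℝ → EucSp 2),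
      ContDiff ℝ ∞ γ ∧
      P.curveLength γ 0 1 ≠ (⨅ T ∈ P.smoothReparamTimes γ 0 1, ENNReal.ofReal T) ∧
      P.curveLength γ 0 1 ≤ 3 / 2 ∧
      ∀ (T : ℝ) (r : ℝ → ℝ), 0 < T → ContDiffOn ℝ 1 r (Icc 0 T) →
        r '' Icc 0 T = Icc 0 1 → P.IsSubunitCurve (γ ∘ r) 0 T → 2 ≤ T) := by
  exact ⟨fun n M _ _ _ _ _ P hdim a b hab γ hγ =>
    P.curveLength_eq_iInf_smoothReparamTimes hdim hab hγ,
    exists_curveLength_ne_iInf_smoothReparamTimes⟩
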